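/- **Setting.** Let $X=(X_1,\dots,X_J,W)$ be a random vector, with controls $W\in\mathbb R^K$ and values in $\mathcal X\subseteq\mathbb R^{J}\times\mathbb R^{K}$, and let $U\in\mathcal U$, $V\in\mathcal V$ be random elements of standard Borel spaces. Let $h:\mathcal X\times\mathcal U\to\mathcal H\subseteq\mathbb R$ and $r:\mathcal H\times\mathcal V\to\{0,1,\dots,\bar R\}$ be measurable, and put $H=h(X,U)$, $R=r(H,V)$. Let $\tau_v(k)=\sup\{y\in\mathcal H: r(y,v)\le k\}\in[-\infty,\infty]$ be the thresholds, $0\le k<\bar R$. For $x\in\mathcal X$ let $w$ denote its last $K$ components. Fix versions $F_{V|W}$ and $F_{U|WV}$ of the conditional distributions of $V$ given $W$ and of $U$ given $(W,V)$. Write "given $x,v$" for the law $F_{U|WV}(\cdot|w,v)$ of $U$, with $H=h(x,U)$. Let $f(\cdot|x,v)$ be a density of $H$ given $x,v$ and let $F_{U|H}(\cdot|y,x,v)$ be a version of the conditional distribution of $U$ given $H=y$ and $x,v$. **Assumptions.** (HONEST) For every $v$, $r(\cdot,v)$ is weakly increasing and left-continuous on $\mathcal H$. (EXOG) $(X_1,\dots,X_J)$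 is independent of $V$ conditional on $W$, and independent of $U$ conditional on $(W,V)$. (REG for $j=1$ and $j=2$) The law of $X_j$ is absolutely continuous. At all $x$ that are interior to $\mathcal X$ in the direction of $x_j$: $h(x,u)$ is differentiable in $x_j$ for every $u$; for all $\alpha\in(0,1)$ and all $v$, the $\alpha$-quantile of $H$ given $x,v$ is differentiable in $x_j$, with derivative at most a constant $M<\infty$; and $(H,\partial_{x_j}h(x,U))$ has, given $x,v$, a joint density $f_j(y,h'|x,v)$ such that $f_j(y,\cdot|x,v)$ is $f(y|x,v)$ times the density of $\partial_{x_j}h(x,U)$ under $F_{U|H}(\cdot|y,x,v)$, $f_j(y,h'|x,v)\le c(h')$ with $c$ not depending on $(y,x,v)$ and $\int c(h')|h'|\,dh'<\infty$, and, for almost every $h'$, $f_j(y,h'|x,v)$ is continuous in $(y,x_j)$ at each finite threshold $y=\tau_v(k)$. **Conditioning on being at a threshold.** Put $w(x,v)=\sum_{k=0}^{\bar R-1}f(\tau_v(k)|x,v)$, with $f(\pm\infty|x,v)=0$. Conditioning on $\{H\in\tau_V,X=x\}$ refers to the following law of $(V,U)$: $V$ has the law $F_{V|W}(\cdot|w)$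 conditioned on $\{v:w(x,v)>0\}$, and given $V=v$, $U$ has the law $\sum_k \frac{f(\tau_v(k)|x,v)}{w(x,v)}F_{U|H}(\cdot|\tau_v(k),x,v)$. **Conclusion.** The function $\mathbb E[R|X=x]:=\int dF_{V|W}(v|w)\int dF_{U|WV}(u|w,v)\, r(h(x,u),v)$ is a version of the conditional expectation of $R$ given $X$. At every $x$ that is interior to $\mathcal X$ in the directions of $x_1$ and $x_2$, it is differentiable in $x_1$ and in $x_2$. Suppose further that, for such an $x$, $V$ and $U$ are independent conditional on $\{H\in\tau_V,X=x\}$ and that the marginal rate of substitution $\partial_{x_1}h(x,U)/\partial_{x_2}h(x,U)$ is integrable under this conditional law. (a) If $\partial_{x_2}\mathbb E[R|X=x]\ne0$ and $\mathrm{Cov}\left(\frac{\partial_{x_1}h(x,U)}{\partial_{x_2}h(x,U)},\partial_{x_2}h(x,U)\,\middle|\,H\in\tau_V,X=x\right)=0$, then $$\mathbb E\left[\frac{\partial_{x_1}h(x,U)}{\partial_{x_2}h(x,U)}\,\middle|\,H\in\tau_V,X=x\right]=\frac{\partial_{x_1}\mathbb E[R|X=x]}{\partial_{x_2}\mathbb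 E[R|X=x]}.$$ (b) If $\partial_{x_2}\mathbb E[R|X=x]>0$ and this covariance is $\le0$ (respectively $\ge0$), then the left-hand side is $\ge$ (respectively $\le$) the right-hand side. -/

import Mathlib

open MeasureTheory ProbabilityTheory Filter Topology
open scoped NNReal ENNReal

noncomputable section

namespace Reporting

/-- Values `x = (x₁, …, x_J, w)` of the explanatory vector: `J` regressors of interest and `K`
controls `w`. -/
abbrev Cov (J K : ℕ) : Type := (Fin J → ℝ) × (Fin K → ℝ)

/-- The point `x` with its `j`-th component (among the first `J`) replaced by `s`. -/
def setComp {J K : ℕ} (x : Cov J K) (j : Fin J) (s : ℝ) : Cov J K :=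
  (Function.update x.1 j s, x.2)

/-- The structural objects: a set `X` of possible values `x`, a set `H ⊆ ℝ` of possible values of
the latent variable, the response space `{0, …, Rbar}`, the structural function `h(x,u)` and the
reporting function `r(y,v)`. Only `x ∈ X` and `y ∈ H` matter. -/
structure Model (J K : ℕ) (U V : Type*) [MeasurableSpace U] [MeasurableSpace V] where
  X : Set (Cov J K)
  H : Set ℝ
  Rbar : ℕ
  h : Cov J K → U → ℝ
  r : ℝ → V → ℕ
  measurable_h : Measurable (Function.uncurry h)
  measurable_r : Measurable (Function.uncurry r)
  h_mem : ∀ x ∈ X, ∀ u, h x u ∈ H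
  r_le : ∀ y ∈ H, ∀ v, r y v ≤ Rbar

section

variable {J K : ℕ} {U V : Type*} [MeasurableSpace U] [MeasurableSpace V]

/-- HONEST: each reporting function is weakly increasing and left-continuous on `H`. -/
def Model.Honest (M : Model J K U V) : Prop :=
  ∀ v, MonotoneOn (fun y => M.r y v) M.H ∧
    ∀ y ∈ M.H, ContinuousWithinAt (fun y' => M.r y' v) (M.H ∩ Set.Iic y) y

/-- The threshold `τ_v(k) = sup {y ∈ H : r(y,v) ≤ k}`, an extended real number. -/
def Model.threshold (M : Model J K U V) (v : V) (k : ℕ) : EReal :=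
  sSup ((fun y : ℝ => (y : EReal)) '' {y | y ∈ M.H ∧ M.r y v ≤ k})

/-- The partial derivative `∂_{x_j} h(x,u)`. -/
def Model.partialH (M : Model J K U V) (j : Fin J) (x : Cov J K) (u : U) : ℝ :=
  deriv (fun s => M.h (setComp x j s) u) (x.1 j)

/-- The marginal rate of substitution `∂_{x_{j₁}} h(x,u) / ∂_{x_{j₂}} h(x,u)`. -/
def Model.mrs (M : Model J K U V) (j₁ j₂ : Fin J) (x : Cov J K) (u : U) : ℝ :=
  M.partialH j₁ x u / M.partialH j₂ x u

/-- The points of `X` that are interior to `X` in the direction of `x_j`. -/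
def Model.interiorDir (M : Model J K U V) (j : Fin J) : Set (Cov J K) :=
  {x | ∀ᶠ s in 𝓝 (x.1 j), setComp x j s ∈ M.X}

/-- EXOG: conditionally on `W`, the regressors `T = (X₁, …, X_J)` are independent of `V`; and
conditionally on `(W, V)` they are independent of `U`. -/
def Exog {Ω : Type*} [MeasurableSpace Ω] [StandardBorelSpace Ω] (P : Measure Ω) [IsFiniteMeasure P]
    (T : Ω → Fin J → ℝ) (W : Ω → Fin K → ℝ) (Uvar : Ω → U) (Vvar : Ω → V)
    (hW : Measurable W) (hV : Measurable Vvar) : Prop :=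
  CondIndepFun (MeasurableSpace.comap W inferInstance) hW.comap_le T Vvar P ∧
  CondIndepFun (MeasurableSpace.comap (fun ω => (W ω, Vvar ω)) inferInstance)
    (hW.prodMk hV).comap_le T Uvar P

/-- Candidates for the conditional distributions that occur in the model:
`lawV w` for `V` given `W = w`; `lawU (w, v)` for `U` given `(W, V) = (w, v)`;
`dens x v` for the density `f(·|x,v)` of the latent variable given `X = x, V = v`;
`lawUH x (v, y)` for `U` given `X = x`, `V = v` and latent value `y`. -/
structure CondLaws (J K : ℕ) (U V : Type*) [MeasurableSpace U] [MeasurableSpace V] where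
  lawV : Kernel (Fin K → ℝ) V
  lawU : Kernel ((Fin K → ℝ) × V) U
  dens : Cov J K → V → ℝ → ℝ≥0
  lawUH : Cov J K → Kernel (V × ℝ) U
  markovV : IsMarkovKernel lawV
  markovU : IsMarkovKernel lawU
  markovUH : ∀ x, IsMarkovKernel (lawUH x)
  measurable_dens : ∀ x, Measurable (Function.uncurry (dens x))

/-- The candidates are versions of the conditional distributions that they stand for. The last
clause says that, when `X = x` and `V = v`, the latent value `h(x,U)` has density `dens x v`, and
`lawUH x (v, ·)` is the conditional distribution of `U` given `h(x,U)`. -/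
structure CondLaws.IsVersion {Ω : Type*} [MeasurableSpace Ω] (C : CondLaws J K U V)
    (M : Model J K U V) (P : Measure Ω)
    (W : Ω → Fin K → ℝ) (Uvar : Ω → U) (Vvar : Ω → V) : Prop where
  condV : HasCondDistrib Vvar W C.lawV P
  condU : HasCondDistrib Uvar (fun ω => (W ω, Vvar ω)) C.lawU P
  condUH : ∀ x ∈ M.X, ∀ v, (C.lawU (x.2, v)).map (fun u => (M.h x u, u)) =
    (volume.withDensity (fun y => (C.dens x v y : ℝ≥0∞))) ⊗ₘ
      ((C.lawUH x).comap (Prod.mk v) measurable_prodMk_left)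

/-- The conditional quantile function `Q(α|x,v)` of the latent variable given `X = x, V = v`. -/
def quantile (M : Model J K U V) (C : CondLaws J K U V) (α : ℝ) (x : Cov J K) (v : V) : ℝ :=
  sInf {y | α ≤ (C.lawU (x.2, v)).real {u | M.h x u ≤ y}}

/-- REG for the regressor `x_j`. The function `g x v y h'` is the joint density
`f_{H,∂_j h|XV}(y,h'|x,v)` of `h(x,U)` and `∂_j h(x,U)` given `X = x, V = v`. -/
structure Reg {Ω : Type*} [MeasurableSpace Ω] (M : Model J K U V) (C : CondLaws J K U V)
    (P : Measure Ω) (T : Ω → Fin J → ℝ) (j : Fin J) : Prop where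
  continuous_regressor : P.map (fun ω => T ω j) ≪ volume
  differentiable : ∀ x ∈ M.interiorDir j, ∀ u,
    DifferentiableAt ℝ (fun s => M.h (setComp x j s) u) (x.1 j)
  quantile_bound : ∃ B : ℝ, ∀ α ∈ Set.Ioo (0 : ℝ) 1, ∀ x ∈ M.interiorDir j, ∀ v,
    DifferentiableAt ℝ (fun s => quantile M C α (setComp x j s) v) (x.1 j) ∧
    deriv (fun s => quantile M C α (setComp x j s) v) (x.1 j) ≤ B
  joint_density : ∃ (g : Cov J K → V → ℝ → ℝ → ℝ≥0) (c : ℝ → ℝ≥0),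
    Integrable (fun h' : ℝ => (c h' : ℝ) * |h'|) volume ∧
    ∀ x ∈ M.interiorDir j, ∀ v,
      (∀ y, Measurable (g x v y) ∧ (∀ h', g x v y h' ≤ c h') ∧
        (C.dens x v y : ℝ≥0∞) • (C.lawUH x (v, y)).map (M.partialH j x) =
          volume.withDensity (fun h' => (g x v y h' : ℝ≥0∞))) ∧
      ∀ k < M.Rbar, M.threshold v k ≠ ⊤ → M.threshold v k ≠ ⊥ →
        ∀ᵐ h' ∂(volume : Measure ℝ),
          ContinuousAt (fun p : ℝ × ℝ => g (setComp x j p.1) v p.2 h')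
            (x.1 j, (M.threshold v k).toReal)

/-- `E[R | X = x] = ∫ dF_{V|W}(v|w) ∫ dF_{U|WV}(u|w,v) r(h(x,u),v)`. -/
def regression (M : Model J K U V) (C : CondLaws J K U V) (x : Cov J K) : ℝ :=
  ∫ v, ∫ u, (M.r (M.h x u) v : ℝ) ∂(C.lawU (x.2, v)) ∂(C.lawV x.2)

/-- The partial derivative `∂_{x_j} E[R | X = x]`. -/
def partialRegression (M : Model J K U V) (C : CondLaws J K U V) (j : Fin J) (x : Cov J K) : ℝ :=
  deriv (fun s => regression M C (setComp x j s)) (x.1 j)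

open Classical in
/-- `f(τ_v(k)|x,v)`, which is `0` at an infinite threshold. -/
def thresholdDens (M : Model J K U V) (C : CondLaws J K U V) (x : Cov J K) (v : V) (k : ℕ) : ℝ≥0 :=
  if M.threshold v k = ⊤ ∨ M.threshold v k = ⊥ then 0
  else C.dens x v (M.threshold v k).toReal

/-- The weight `w(x,v) = ∑_k f(τ_v(k)|x,v)`, over `k = 0, …, Rbar - 1`. -/
def weight (M : Model J K U V) (C : CondLaws J K U V) (x : Cov J K) (v : V) : ℝ≥0 :=
  ∑ k ∈ Finset.range M.Rbar, thresholdDens M C x v k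

/-- The distribution of `U` given `H ∈ τ_v, X = x, V = v`: the latent value is at the `k`-th
threshold with probability `f(τ_v(k)|x,v) / w(x,v)`. -/
def thresholdLaw (M : Model J K U V) (C : CondLaws J K U V) (x : Cov J K) (v : V) : Measure U :=
  ∑ k ∈ Finset.range M.Rbar,
    ((thresholdDens M C x v k / weight M C x v : ℝ≥0) : ℝ≥0∞) •
      C.lawUH x (v, (M.threshold v k).toReal)

/-- The distribution of `(V, U)` given `H ∈ τ_V, X = x`, that is the one with
`E[w(x,V) G(V,U) | H ∈ τ_V, X = x] ∝ E[∑_k f(τ_V(k)|x,V) E[G(V,U) | H = τ_V(k), x, V] | X = x]`: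
first `V` is drawn from its distribution given `X = x`, among the values `v` that have a positive
density at some threshold, then `U` from its distribution given `H ∈ τ_v, X = x, V = v`. -/
def localLaw (M : Model J K U V) (C : CondLaws J K U V) (x : Cov J K) : Measure (V × U) :=
  (ProbabilityTheory.cond (C.lawV x.2) {v | 0 < weight M C x v}).bind
    (fun v => (thresholdLaw M C x v).map (Prod.mk v))

end

end Reporting

end

/-! The report is a count of thresholds: `R` is the number of `k < Rbar` with `R > k`, and given `v`
the event `R > k` is, up to a null set, the event that the latent variable exceeds `τ_v(k)`. Moving
`x_j` changes the probability of exceeding a level `y` at the rate `f(y|x,v) E[∂_j h | H = y, x, v]`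
(`levelSlope`), because only those at the margin switch. So `∂_j E[R|X=x]` is the integral over `v`
of the sum over `k` of these rates at the thresholds (`SlopeBound.hasDerivAt_regression`).

The rate is justified by smoothing. For a smooth step `ψ`, the derivative of `E ψ(h)` is an average
of `levelSlope` near the level; joint continuity at the threshold lets the step sharpen
(`abs_measureReal_gt_sub_sub_le`). The dominating function `c` of REG gives a Lipschitz constant
free of `v` and of the level, which permits differentiating under the law of `V`.

In terms of `localLaw`, the partial effect of `x_j` is `P(w > 0)` times the local mean of `w(x,V)
∂_j h(x,U)`. Independence of `V` and `U` factors out the mean of `w`, so both partial effects are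
the same positive multiple of the local means of `∂_1 h` and `∂_2 h` (`exists_pos_partial_effects`).
Since `∂_2 h` is almost surely nonzero, `E[∂_1 h] = E[MRS ∂_2 h] = Cov(MRS, ∂_2 h) + E[MRS] E[∂_2
h]`, and the sign of the covariance decides the comparison. -/

/-! ### Conditional distributions under conditional independence. -/

namespace ProbabilityTheory

variable {Ω α β γ : Type*} {mΩ : MeasurableSpace Ω} {mα : MeasurableSpace α}
  {mβ : MeasurableSpace β} {mγ : MeasurableSpace γ} {P : Measure Ω}

/-- Conditional independence lets one add the independent variable to the conditioning. -/
lemma HasCondDistrib.prodMkRight_of_condIndepFun [StandardBorelSpace Ω] [IsFiniteMeasure P]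
    [StandardBorelSpace α] [Nonempty α] [StandardBorelSpace β] [Nonempty β]
    {Y : Ω → α} {T : Ω → β} {k : Ω → γ} {κ : Kernel γ α} [IsMarkovKernel κ]
    (hY : Measurable Y) (hT : Measurable T) (hk : Measurable k)
    (hκ : HasCondDistrib Y k κ P)
    (h : CondIndepFun (MeasurableSpace.comap k inferInstance) hk.comap_le T Y P) :
    HasCondDistrib Y (fun ω => (k ω, T ω)) (κ.prodMkRight β) P where
  aemeasurable := by fun_prop
  map_eq := by
    rw [condIndepFun_iff_condDistrib_prod_ae_eq_prodMkRight hY hT hk] at h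
    have h1 : condDistrib Y k P =ᵐ[P.map k] κ :=
      condDistrib_ae_eq_of_measure_eq_compProd k hY.aemeasurable hκ.map_eq
    have h2 : (condDistrib Y k P).prodMkRight β =ᵐ[P.map (fun ω => (k ω, T ω))]
        κ.prodMkRight β := by
      have h3 : P.map k = (P.map (fun ω => (k ω, T ω))).map Prod.fst := by
        rw [Measure.map_map measurable_fst (hk.prodMk hT)]; rfl
      rw [h3] at h1
      filter_upwards [ae_of_ae_map measurable_fst.aemeasurable h1] with p hp
      simpa [Kernel.prodMkRight_apply] using hp
    rw [← Measure.compProd_congr (h.trans h2), compProd_map_condDistrib hY.aemeasurable]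

/-- Successive conditional distributions give the conditional distribution of a pair. -/
lemma HasCondDistrib.compProd [SFinite P] {X : Ω → α} {Y : Ω → β} {Z : Ω → γ}
    {κ : Kernel α β} {η : Kernel (α × β) γ} [IsSFiniteKernel κ] [IsSFiniteKernel η]
    (hY : HasCondDistrib Y X κ P) (hZ : HasCondDistrib Z (fun ω => (X ω, Y ω)) η P) :
    HasCondDistrib (fun ω => (Y ω, Z ω)) X (κ ⊗ₖ η) P where
  aemeasurable := by
    have := hY.aemeasurable_fst
    have := hY.aemeasurable_snd
    have := hZ.aemeasurable_snd
    fun_prop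
  map_eq := by
    have h1 := hY.aemeasurable_fst
    have h2 := hY.aemeasurable_snd
    have h3 := hZ.aemeasurable_snd
    -- The two ways of composing live on differently bracketed products; they are compared after
    -- reassociation, which is injective on measures.
    have e : (P.map X ⊗ₘ (κ ⊗ₖ η)).map MeasurableEquiv.prodAssoc.symm
        = (P.map fun ω => (X ω, Y ω, Z ω)).map MeasurableEquiv.prodAssoc.symm := by
      rw [Measure.compProd_assoc, ← hY.map_eq, ← hZ.map_eq,
        AEMeasurable.map_map_of_aemeasurable (by fun_prop) (by fun_prop)]
      rfl
    exact ((MeasurableEquiv.map_measurableEquiv_injective _ e)).symm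

/-- Conditional expectations computed from a version of the conditional distribution. -/
lemma HasCondDistrib.condExp_ae_eq [IsFiniteMeasure P] [StandardBorelSpace β] [Nonempty β]
    {X : Ω → α} {Y : Ω → β} {κ : Kernel α β} [IsMarkovKernel κ]
    (hX : Measurable X) (hY : Measurable Y) (h : HasCondDistrib Y X κ P)
    {f : α × β → ℝ} (hf : StronglyMeasurable f) (hf_int : Integrable (fun ω => f (X ω, Y ω)) P) :
    P[fun ω => f (X ω, Y ω) | mα.comap X] =ᵐ[P] fun ω => ∫ y, f (X ω, y) ∂(κ (X ω)) := by
  have h1 : condDistrib Y X P =ᵐ[P.map X] κ :=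
    condDistrib_ae_eq_of_measure_eq_compProd X hY.aemeasurable h.map_eq
  filter_upwards [condExp_prod_ae_eq_integral_condDistrib hX hY.aemeasurable hf hf_int,
    ae_of_ae_map hX.aemeasurable h1] with ω hω1 hω2
  rw [hω1, hω2]

end ProbabilityTheory

/-! ### The regression function as a conditional expectation. -/

namespace Reporting

variable {J K : ℕ} {U V Ω : Type*} [MeasurableSpace U] [MeasurableSpace V] [MeasurableSpace Ω]

/-- The conditional distribution of `(V, U)` given `X = x`. -/
noncomputable def CondLaws.lawVU (C : CondLaws J K U V) : Kernel (Cov J K) (V × U) :=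
  (C.lawV.comap Prod.snd measurable_snd) ⊗ₖ
    (C.lawU.comap (fun p : Cov J K × V => (p.1.2, p.2)) (by fun_prop))

instance (C : CondLaws J K U V) : IsMarkovKernel C.lawV := C.markovV
instance (C : CondLaws J K U V) : IsMarkovKernel C.lawU := C.markovU
instance (C : CondLaws J K U V) (x : Cov J K) : IsMarkovKernel (C.lawUH x) := C.markovUH x
instance (C : CondLaws J K U V) : IsMarkovKernel C.lawVU := by
  unfold CondLaws.lawVU; infer_instance

lemma Model.measurable_response (M : Model J K U V) :
    Measurable (fun q : Cov J K × V × U => (M.r (M.h q.1 q.2.2) q.2.1 : ℝ)) :=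
  (measurable_from_top (f := fun n : ℕ => (n : ℝ))).comp
    (M.measurable_r.comp ((M.measurable_h.comp (by fun_prop :
      Measurable (fun q : Cov J K × V × U => (q.1, q.2.2)))).prodMk (by fun_prop)))

lemma integrable_response (M : Model J K U V) (C : CondLaws J K U V) {x : Cov J K}
    (hx : x ∈ M.X) : Integrable (fun q : V × U => (M.r (M.h x q.2) q.1 : ℝ)) (C.lawVU x) := by
  have hm : Measurable (fun q : V × U => (M.r (M.h x q.2) q.1 : ℝ)) :=
    M.measurable_response.comp (measurable_const.prodMk measurable_id)
  refine Integrable.of_bound (C := M.Rbar) hm.aestronglyMeasurable (ae_of_all _ fun q => ?_)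
  simpa using M.r_le _ (M.h_mem x hx q.2) q.1

lemma regression_eq_integral_lawVU (M : Model J K U V) (C : CondLaws J K U V) {x : Cov J K} (hx : x ∈ M.X) :
    regression M C x = ∫ q, (M.r (M.h x q.2) q.1 : ℝ) ∂(C.lawVU x) := by
  rw [CondLaws.lawVU, integral_compProd (integrable_response M C hx)]
  rfl

section Regression

variable [StandardBorelSpace U] [StandardBorelSpace V] [StandardBorelSpace Ω]
  {P : Measure Ω} [IsProbabilityMeasure P] {M : Model J K U V} {C : CondLaws J K U V}
  {T : Ω → Fin J → ℝ} {W : Ω → Fin K → ℝ} {Uvar : Ω → U} {Vvar : Ω → V}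

/-- The given kernels condition on `W` and `(W, V)` only. The two halves of EXOG allow `T` to be
added to each conditioning, after which they chain. -/
lemma hasCondDistrib_lawVU
    (hT : Measurable T) (hW : Measurable W) (hU : Measurable Uvar) (hV : Measurable Vvar)
    (hC : C.IsVersion M P W Uvar Vvar) (hExog : Exog P T W Uvar Vvar hW hV) :
    HasCondDistrib (fun ω => (Vvar ω, Uvar ω)) (fun ω => (T ω, W ω)) C.lawVU P := by
  have : Nonempty Ω := nonempty_of_isProbabilityMeasure P
  have : Nonempty V := this.map Vvar
  have : Nonempty U := ‹Nonempty Ω›.map Uvar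
  refine HasCondDistrib.compProd ?_ ?_
  · exact HasCondDistrib.comp_right (Z := fun ω => (W ω, T ω)) (f := Prod.swap)
      (hf := measurable_swap)
      (hC.condV.prodMkRight_of_condIndepFun hV hT hW hExog.1)
  · exact HasCondDistrib.comp_right (Z := fun ω => ((W ω, Vvar ω), T ω))
      (f := fun p : ((Fin K → ℝ) × V) × (Fin J → ℝ) => ((p.2, p.1.1), p.1.2))
      (hf := by fun_prop)
      (hC.condU.prodMkRight_of_condIndepFun hU hT (hW.prodMk hV) hExog.2)

theorem regression_ae_eq_condExp
    (hT : Measurable T) (hW : Measurable W) (hU : Measurable Uvar) (hV : Measurable Vvar)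
    (hX : ∀ᵐ ω ∂P, (T ω, W ω) ∈ M.X)
    (hC : C.IsVersion M P W Uvar Vvar) (hExog : Exog P T W Uvar Vvar hW hV) :
    (fun ω => regression M C (T ω, W ω)) =ᵐ[P]
      P[fun ω => (M.r (M.h (T ω, W ω) (Uvar ω)) (Vvar ω) : ℝ) |
        MeasurableSpace.comap (fun ω => (T ω, W ω)) inferInstance] := by
  have : Nonempty Ω := nonempty_of_isProbabilityMeasure P
  have : Nonempty V := this.map Vvar
  have : Nonempty U := ‹Nonempty Ω›.map Uvar
  have hint : Integrable (fun ω => (M.r (M.h (T ω, W ω) (Uvar ω)) (Vvar ω) : ℝ)) P := by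
    refine Integrable.of_bound (C := M.Rbar)
      (M.measurable_response.comp (f := fun ω => ((T ω, W ω), Vvar ω, Uvar ω))
        (by fun_prop)).aestronglyMeasurable ?_
    filter_upwards [hX] with ω hω
    simpa using M.r_le _ (M.h_mem _ hω (Uvar ω)) (Vvar ω)
  have key := (hasCondDistrib_lawVU hT hW hU hV hC hExog).condExp_ae_eq (hT.prodMk hW)
    (hV.prodMk hU) M.measurable_response.stronglyMeasurable hint
  filter_upwards [key, hX] with ω hω1 hω2
  rw [hω1, regression_eq_integral_lawVU M C hω2]

end Regression

end Reporting

/-! ### Differentiating the probability that a parametrised random variable exceeds a level. -/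

namespace MeasureTheory

open Set intervalIntegral
open scoped Interval

variable {U : Type*} [MeasurableSpace U]

lemma tendsto_one_div_add_atTop_nhdsNE_zero :
    Tendsto (fun n : ℕ => 1 / ((n : ℝ) + 1)) atTop (𝓝[≠] 0) :=
  tendsto_nhdsWithin_iff.2 ⟨tendsto_one_div_add_atTop_nhds_zero_nat,
    Eventually.of_forall fun n => (Nat.one_div_pos_of_nat (n := n)).ne'⟩

/-- The partial derivative of a jointly measurable function is jointly a.e. measurable wherever it
exists. -/
lemma aestronglyMeasurable_deriv_uncurry {φ : ℝ → U → ℝ} (hφ : Measurable (Function.uncurry φ))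
    {ν : Measure (ℝ × U)} (h : ∀ᵐ p ∂ν, DifferentiableAt ℝ (fun s => φ s p.2) p.1) :
    AEStronglyMeasurable (fun p : ℝ × U => deriv (fun s => φ s p.2) p.1) ν := by
  refine aestronglyMeasurable_of_tendsto_ae atTop
    (f := fun (n : ℕ) (p : ℝ × U) => (1 / ((n : ℝ) + 1))⁻¹ *
      (φ (p.1 + 1 / ((n : ℝ) + 1)) p.2 - φ p.1 p.2)) (fun n => ?_) ?_
  · have h1 : Measurable fun p : ℝ × U => φ (p.1 + 1 / ((n : ℝ) + 1)) p.2 :=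
      hφ.comp ((measurable_fst.add_const _).prodMk measurable_snd)
    exact ((h1.sub hφ).const_mul _).aestronglyMeasurable
  · filter_upwards [h] with p hp
    exact hp.hasDerivAt.tendsto_slope_zero.comp tendsto_one_div_add_atTop_nhdsNE_zero

/-- The derivative in a parameter of a measurable function of the second variable is measurable. -/
lemma measurable_deriv_of_forall_differentiableAt {φ : ℝ → U → ℝ} (hφ : ∀ s, Measurable (φ s))
    {s₀ : ℝ} (h : ∀ u, DifferentiableAt ℝ (fun s => φ s u) s₀) :
    Measurable fun u => deriv (fun s => φ s u) s₀ := by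
  refine measurable_of_tendsto_metrizable
    (f := fun (n : ℕ) u => (1 / ((n : ℝ) + 1))⁻¹ * (φ (s₀ + 1 / ((n : ℝ) + 1)) u - φ s₀ u))
    (fun n => ((hφ _).sub (hφ _)).const_mul _) (tendsto_pi_nhds.2 fun u => ?_)
  exact (h u).hasDerivAt.tendsto_slope_zero.comp tendsto_one_div_add_atTop_nhdsNE_zero

/-- A smoothed unit step: its derivative is a probability density on `[y₀, y₀ + η]`. -/
lemma exists_smooth_step (y₀ : ℝ) {η : ℝ} (hη : 0 < η) :
    ∃ ψ q : ℝ → ℝ, (∀ y, HasDerivAt ψ (q y) y) ∧ Continuous q ∧ (∀ y, 0 ≤ q y) ∧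
      (∀ y ∉ Icc y₀ (y₀ + η), q y = 0) ∧ Integrable q ∧ ∫ y, q y = 1 ∧
      (∀ y, 0 ≤ ψ y ∧ ψ y ≤ 1) ∧ (∀ y ≤ y₀, ψ y = 0) ∧ ∀ y, y₀ + η ≤ y → ψ y = 1 := by
  set ψ : ℝ → ℝ := fun y => Real.smoothTransition ((y - y₀) / η) with hψ
  have hsm : ContDiff ℝ 1 ψ :=
    (Real.smoothTransition.contDiff (n := 1)).comp ((contDiff_id.sub contDiff_const).div_const η)
  have hd : ∀ y, HasDerivAt ψ (deriv ψ y) y := fun y =>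
    ((hsm.differentiable (by norm_num)) y).hasDerivAt
  have hc : Continuous (deriv ψ) := hsm.continuous_deriv le_rfl
  have hmono : Monotone ψ := fun a b hab =>
    Real.smoothTransition.monotone (div_le_div_of_nonneg_right (by linarith) hη.le)
  have h0 : ∀ y ≤ y₀, ψ y = 0 := fun y hy =>
    Real.smoothTransition.zero_of_nonpos (div_nonpos_of_nonpos_of_nonneg (by linarith) hη.le)
  have h1 : ∀ y, y₀ + η ≤ y → ψ y = 1 := fun y hy =>
    Real.smoothTransition.one_of_one_le ((one_le_div hη).2 (by linarith))
  have hsupp : ∀ y ∉ Icc y₀ (y₀ + η), deriv ψ y = 0 := by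
    intro y hy
    rw [mem_Icc, not_and_or, not_le, not_le] at hy
    rcases hy with hy | hy
    · have : ψ =ᶠ[𝓝 y] fun _ => 0 := by
        filter_upwards [Iio_mem_nhds hy] with z hz using h0 z (le_of_lt hz)
      simpa using this.deriv_eq
    · have : ψ =ᶠ[𝓝 y] fun _ => 1 := by
        filter_upwards [Ioi_mem_nhds hy] with z hz using h1 z (le_of_lt hz)
      simpa using this.deriv_eq
  have hint : Integrable (deriv ψ) :=
    hc.integrable_of_hasCompactSupport (HasCompactSupport.intro isCompact_Icc hsupp)
  refine ⟨ψ, deriv ψ, hd, hc, fun y => hmono.deriv_nonneg, hsupp, hint, ?_, fun y =>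
    ⟨Real.smoothTransition.nonneg _, Real.smoothTransition.le_one _⟩, h0, h1⟩
  rw [integral_of_hasDerivAt_of_tendsto (f := ψ) (m := 0) (n := 1) hd hint]
  · norm_num
  · exact tendsto_const_nhds.congr' ((eventually_le_atBot y₀).mono fun y hy => (h0 y hy).symm)
  · exact tendsto_const_nhds.congr' ((eventually_ge_atTop (y₀ + η)).mono fun y hy => (h1 y hy).symm)

variable {ρ : Measure U} [IsProbabilityMeasure ρ] {φ : ℝ → U → ℝ} {m : ℝ → ℝ → ℝ} {c : ℝ≥0∞}
  {a b : ℝ}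

/-- Increments of `s ↦ E ψ(φ_s)`, when `m s y` is the product of the density of `φ_s` at `y` with
the conditional mean of `∂_s φ_s` given `φ_s = y`. -/
lemma integral_comp_sub_integral_comp (hφ : Measurable (Function.uncurry φ))
    (hd : ∀ s ∈ [[a, b]], ∀ u, DifferentiableAt ℝ (fun t => φ t u) s) (hc : c ≠ ∞)
    (hbound : ∀ s ∈ [[a, b]], ∀ q : ℝ → ℝ≥0∞, Measurable q →
      ∫⁻ u, q (φ s u) * ‖deriv (fun t => φ t u) s‖ₑ ∂ρ ≤ c * ∫⁻ y, q y)
    (hint : ∀ s ∈ [[a, b]], ∀ q : ℝ → ℝ, Measurable q → Integrable q →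
      ∫ u, q (φ s u) * deriv (fun t => φ t u) s ∂ρ = ∫ y, q y * m s y)
    {ψ q : ℝ → ℝ} (hψ : ∀ y, HasDerivAt ψ (q y) y) (hqc : Continuous q) (hqi : Integrable q)
    (hψb : ∀ y, 0 ≤ ψ y ∧ ψ y ≤ 1) :
    IntervalIntegrable (fun s => ∫ y, q y * m s y) volume a b ∧
      ∫ u, ψ (φ b u) ∂ρ - ∫ u, ψ (φ a u) ∂ρ = ∫ s in a..b, ∫ y, q y * m s y := by
  have hψm : Measurable ψ :=
    (continuous_iff_continuousAt.2 fun y => (hψ y).continuousAt).measurable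
  have hφs : ∀ s, Measurable (φ s) := fun s => hφ.comp measurable_prodMk_left
  have hψi : ∀ s, Integrable (fun u => ψ (φ s u)) ρ := fun s =>
    Integrable.of_bound (C := 1) (hψm.comp (hφs s)).aestronglyMeasurable (ae_of_all _ fun u => by
      rw [Real.norm_eq_abs, abs_of_nonneg (hψb _).1]; exact (hψb _).2)
  set F : ℝ → U → ℝ := fun s u => q (φ s u) * deriv (fun t => φ t u) s with hF
  have hdF : ∀ s ∈ [[a, b]], ∀ u, HasDerivAt (fun t => ψ (φ t u)) (F s u) s := fun s hs u =>
    (hψ (φ s u)).comp s (hd s hs u).hasDerivAt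
  have hmem : ∀ᵐ p ∂((volume.restrict (Ι a b)).prod ρ), p.1 ∈ Ι a b :=
    Measure.quasiMeasurePreserving_fst.ae (ae_restrict_mem measurableSet_uIoc)
  have hFm : AEStronglyMeasurable (Function.uncurry F) ((volume.restrict (Ι a b)).prod ρ) := by
    refine AEStronglyMeasurable.mul (hqc.measurable.comp hφ).aestronglyMeasurable
      (aestronglyMeasurable_deriv_uncurry hφ ?_)
    filter_upwards [hmem] with p hp using hd _ (uIoc_subset_uIcc hp) _
  have hFi : Integrable (Function.uncurry F) ((volume.restrict (Ι a b)).prod ρ) := by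
    refine ⟨hFm, ?_⟩
    rw [HasFiniteIntegral, lintegral_prod _ hFm.enorm]
    have h1 : ∀ s ∈ Ι a b, ∫⁻ u, ‖Function.uncurry F (s, u)‖ₑ ∂ρ ≤ c * ∫⁻ y, ‖q y‖ₑ := by
      intro s hs
      simp only [Function.uncurry, hF, enorm_mul]
      exact hbound s (uIoc_subset_uIcc hs) _ hqc.measurable.enorm
    calc _ ≤ ∫⁻ s in Ι a b, c * ∫⁻ y, ‖q y‖ₑ := setLIntegral_mono' measurableSet_uIoc h1
      _ < ∞ := by
        rw [setLIntegral_const]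
        refine ENNReal.mul_lt_top (ENNReal.mul_lt_top hc.lt_top hqi.2) ?_
        rw [uIoc, Real.volume_Ioc]; exact ENNReal.ofReal_lt_top
  -- The path `s ↦ φ s u` is differentiable but perhaps not `C¹`; the fundamental theorem of
  -- calculus needs only an integrable derivative, which Fubini provides for almost every `u`.
  have hFTC : ∀ᵐ u ∂ρ, ∫ s in a..b, F s u = ψ (φ b u) - ψ (φ a u) := by
    filter_upwards [hFi.prod_left_ae] with u hu
    exact integral_eq_sub_of_hasDerivAt (fun s hs => hdF s hs u) (intervalIntegrable_iff.2 hu)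
  refine ⟨intervalIntegrable_iff.2 (hFi.integral_prod_left.congr ?_), ?_⟩
  · filter_upwards [ae_restrict_mem measurableSet_uIoc] with s hs
    exact hint s (uIoc_subset_uIcc hs) q hqc.measurable hqi
  rw [← integral_sub (hψi b) (hψi a), ← integral_congr_ae hFTC, ← intervalIntegral_integral_swap hFi]
  refine intervalIntegral.integral_congr fun s hs => ?_
  exact hint s hs q hqc.measurable hqi

/-- The mean value inequality for `s ↦ P(φ_s > y₀)`. -/
lemma abs_measureReal_gt_sub_sub_le (hφ : Measurable (Function.uncurry φ))
    (hd : ∀ s ∈ [[a, b]], ∀ u, DifferentiableAt ℝ (fun t => φ t u) s) (hc : c ≠ ∞)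
    (hm : ∀ s ∈ [[a, b]], Measurable (m s))
    (hbound : ∀ s ∈ [[a, b]], ∀ q : ℝ → ℝ≥0∞, Measurable q →
      ∫⁻ u, q (φ s u) * ‖deriv (fun t => φ t u) s‖ₑ ∂ρ ≤ c * ∫⁻ y, q y)
    (hint : ∀ s ∈ [[a, b]], ∀ q : ℝ → ℝ, Measurable q → Integrable q →
      ∫ u, q (φ s u) * deriv (fun t => φ t u) s ∂ρ = ∫ y, q y * m s y)
    {y₀ δ L ε : ℝ} (hδ : 0 < δ)
    (hL : ∀ s ∈ [[a, b]], ∀ y ∈ Icc y₀ (y₀ + δ), |m s y - L| ≤ ε) :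
    |ρ.real {u | y₀ < φ b u} - ρ.real {u | y₀ < φ a u} - L * (b - a)| ≤ ε * |b - a| := by
  -- The steps rise to the right of `y₀`, within the interval where `hL` applies, and vanish at
  -- `y₀`; so they converge pointwise to the indicator of the strict inequality.
  choose ψ q hψ hqc hq0 hqs hqi hq1 hψb hψ0 hψ1 using
    fun n : ℕ => exists_smooth_step y₀ (η := δ / (n + 1)) (by positivity)
  have hφs : ∀ s, Measurable (φ s) := fun s => hφ.comp measurable_prodMk_left
  have hlim : ∀ s, Tendsto (fun n => ∫ u, ψ n (φ s u) ∂ρ) atTop (𝓝 (ρ.real {u | y₀ < φ s u})) := by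
    intro s
    have hset : MeasurableSet {u | y₀ < φ s u} := measurableSet_lt measurable_const (hφs s)
    rw [← integral_indicator_one hset]
    refine tendsto_integral_of_dominated_convergence (fun _ => 1) (fun n => ?_)
      (integrable_const _) (fun n => ae_of_all _ fun u => ?_) (ae_of_all _ fun u => ?_)
    · exact ((continuous_iff_continuousAt.2 fun y => (hψ n y).continuousAt).measurable.comp
        (hφs s)).aestronglyMeasurable
    · rw [Real.norm_eq_abs, abs_of_nonneg (hψb n _).1]; exact (hψb n _).2
    · by_cases hu : y₀ < φ s u
      · rw [indicator_of_mem (by exact hu)]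
        have h1 : Tendsto (fun n : ℕ => y₀ + δ / ((n : ℝ) + 1)) atTop (𝓝 y₀) := by
          simpa [div_eq_mul_inv] using
            (tendsto_one_div_add_atTop_nhds_zero_nat.const_mul δ).const_add y₀
        refine tendsto_const_nhds.congr' ?_
        filter_upwards [h1.eventually_lt_const hu] with n hn
        exact (hψ1 n _ hn.le).symm
      · rw [indicator_of_notMem (by exact hu)]
        exact tendsto_const_nhds.congr fun n => (hψ0 n _ (not_lt.1 hu)).symm
  refine le_of_tendsto ((((hlim b).sub (hlim a)).sub_const _).abs) (Eventually.of_forall fun n => ?_)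
  obtain ⟨hI, hinc⟩ :=
    integral_comp_sub_integral_comp hφ hd hc hbound hint (hψ n) (hqc n) (hqi n) (hψb n)
  rw [hinc]
  have hsub : Icc y₀ (y₀ + δ / ((n : ℝ) + 1)) ⊆ Icc y₀ (y₀ + δ) := by
    refine Icc_subset_Icc_right ?_
    have : δ / ((n : ℝ) + 1) ≤ δ := div_le_self hδ.le (by linarith [n.cast_nonneg (α := ℝ)])
    linarith
  have hpt : ∀ s ∈ [[a, b]], ∀ y, ‖q n y * (m s y - L)‖ ≤ q n y * ε := by
    intro s hs y
    by_cases hy : y ∈ Icc y₀ (y₀ + δ / ((n : ℝ) + 1))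
    · rw [norm_mul, Real.norm_of_nonneg (hq0 n y)]
      exact mul_le_mul_of_nonneg_left (hL s hs y (hsub hy)) (hq0 n y)
    · simp [hqs n y hy]
  -- As `q n` is a probability density, the integral is an average of values within `ε` of `L`.
  have hinn : ∀ s ∈ [[a, b]], |(∫ y, q n y * m s y) - L| ≤ ε := by
    intro s hs
    have hi : Integrable fun y => q n y * (m s y - L) :=
      Integrable.mono' ((hqi n).mul_const ε)
        ((hqc n).measurable.mul ((hm s hs).sub_const L)).aestronglyMeasurable
        (ae_of_all _ (hpt s hs))
    have e : (∫ y, q n y * m s y) - L = ∫ y, q n y * (m s y - L) := by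
      have h2 : (fun y => q n y * m s y) = fun y => q n y * (m s y - L) + q n y * L := by
        ext y; ring
      rw [h2, integral_add hi ((hqi n).mul_const L), integral_mul_const, hq1 n]
      ring
    rw [e]
    calc _ ≤ ∫ y, q n y * ε := norm_integral_le_of_norm_le ((hqi n).mul_const ε)
            (ae_of_all _ (hpt s hs))
      _ = ε := by rw [integral_mul_const, hq1 n, one_mul]
  have e : (∫ s in a..b, ∫ y, q n y * m s y) - L * (b - a)
      = ∫ s in a..b, ((∫ y, q n y * m s y) - L) := by
    rw [intervalIntegral.integral_sub hI intervalIntegrable_const, intervalIntegral.integral_const,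
      smul_eq_mul, mul_comm L]
  rw [e, ← Real.norm_eq_abs]
  exact intervalIntegral.norm_integral_le_of_norm_le_const
    fun s hs => hinn s (uIoc_subset_uIcc hs)

end MeasureTheory

/-! ### Consequences of REG: bounds and derivatives for the law of the latent variable. -/

namespace Reporting

variable {J K : ℕ} {U V Ω : Type*} [MeasurableSpace U] [MeasurableSpace V] [MeasurableSpace Ω]
  {M : Model J K U V} {C : CondLaws J K U V}

@[simp] lemma setComp_self (x : Cov J K) (j : Fin J) : setComp x j (x.1 j) = x := by
  simp [setComp]

@[simp] lemma setComp_setComp (x : Cov J K) (j : Fin J) (s t : ℝ) :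
    setComp (setComp x j s) j t = setComp x j t := by
  simp [setComp]

@[simp] lemma setComp_fst_apply (x : Cov J K) (j : Fin J) (s : ℝ) : (setComp x j s).1 j = s := by
  simp [setComp]

@[simp] lemma setComp_snd (x : Cov J K) (j : Fin J) (s : ℝ) : (setComp x j s).2 = x.2 := rfl

lemma measurable_setComp (x : Cov J K) (j : Fin J) : Measurable (setComp x j) :=
  ((continuous_const (y := x.1)).update j continuous_id).measurable.prodMk measurable_const

lemma Model.measurable_h_right (M : Model J K U V) (x : Cov J K) : Measurable (M.h x) :=
  M.measurable_h.comp measurable_prodMk_left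

lemma Model.measurable_h_setComp (M : Model J K U V) (x : Cov J K) (j : Fin J) :
    Measurable (Function.uncurry fun s u => M.h (setComp x j s) u) :=
  M.measurable_h.comp (((measurable_setComp x j).comp measurable_fst).prodMk measurable_snd)

lemma Model.partialH_setComp (M : Model J K U V) (x : Cov J K) (j : Fin J) (s : ℝ) (u : U) :
    M.partialH j (setComp x j s) u = deriv (fun t => M.h (setComp x j t) u) s := by
  simp [Model.partialH]

lemma mem_of_mem_interiorDir {j : Fin J} {x : Cov J K} (hx : x ∈ M.interiorDir j) : x ∈ M.X := by
  simpa using hx.self_of_nhds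

lemma eventually_mem_interiorDir {j : Fin J} {x : Cov J K} (hx : x ∈ M.interiorDir j) :
    ∀ᶠ s in 𝓝 (x.1 j), setComp x j s ∈ M.interiorDir j := by
  filter_upwards [hx.eventually_nhds] with s hs
  simpa [Model.interiorDir] using hs

/-- The density of the latent variable at `y`, times the conditional mean of `∂_j h` there. -/
noncomputable def levelSlope (M : Model J K U V) (C : CondLaws J K U V) (j : Fin J) (x : Cov J K)
    (v : V) (y : ℝ) : ℝ :=
  C.dens x v y * ∫ u, M.partialH j x u ∂(C.lawUH x (v, y))

/-- The consequences of REG that concern a fixed bound `B` on the mean derivative of `h` per unit of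
latent density. -/
structure SlopeBound (M : Model J K U V) (C : CondLaws J K U V) (j : Fin J) (B : ℝ≥0) : Prop where
  measurable_partialH : ∀ x ∈ M.interiorDir j, Measurable (M.partialH j x)
  differentiable : ∀ x ∈ M.interiorDir j, ∀ u,
    DifferentiableAt ℝ (fun s => M.h (setComp x j s) u) (x.1 j)
  lintegral_le : ∀ x ∈ M.interiorDir j, ∀ v y,
    (C.dens x v y : ℝ≥0∞) * ∫⁻ u, ‖M.partialH j x u‖ₑ ∂(C.lawUH x (v, y)) ≤ B
  ae_ne_zero : ∀ x ∈ M.interiorDir j, ∀ v y, C.dens x v y ≠ 0 →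
    ∀ᵐ u ∂(C.lawUH x (v, y)), M.partialH j x u ≠ 0
  continuousAt : ∀ x ∈ M.interiorDir j, ∀ v, ∀ k < M.Rbar,
    M.threshold v k ≠ ⊤ → M.threshold v k ≠ ⊥ →
    ContinuousAt (fun p : ℝ × ℝ => levelSlope M C j (setComp x j p.1) v p.2)
      (x.1 j, (M.threshold v k).toReal)

/-- Everything is read off the joint density `g`: `levelSlope` is the integral of `h' g(y,h')` over
`h'`. The bound `g ≤ c` gives `B = ∫ c |h'|`, dominated convergence gives continuity at the
thresholds, and absolute continuity of the law of `∂_j h` excludes the value zero. -/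
lemma Reg.exists_slopeBound {P : Measure Ω} {T : Ω → Fin J → ℝ} {j : Fin J}
    (hR : Reg M C P T j) : ∃ B : ℝ≥0, SlopeBound M C j B := by
  obtain ⟨g, c, hc, hg⟩ := hR.joint_density
  have hmeas : ∀ x ∈ M.interiorDir j, Measurable (M.partialH j x) := fun x hx =>
    measurable_deriv_of_forall_differentiableAt (φ := fun s u => M.h (setComp x j s) u)
      (fun s => M.measurable_h_right _) (hR.differentiable x hx)
  have hslope : ∀ x ∈ M.interiorDir j, ∀ v y,
      levelSlope M C j x v y = ∫ h', (g x v y h' : ℝ) * h' := by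
    intro x hx v y
    obtain ⟨hgm, -, hgd⟩ := (hg x hx v).1 y
    calc levelSlope M C j x v y
        = ∫ h', h' ∂((C.dens x v y : ℝ≥0∞) • (C.lawUH x (v, y)).map (M.partialH j x)) := by
          rw [integral_smul_measure, integral_map (f := fun h' : ℝ => h')
            (hmeas x hx).aemeasurable measurable_id.aestronglyMeasurable]
          rfl
      _ = ∫ h', (g x v y h' : ℝ) * h' := by
          rw [hgd, integral_withDensity_eq_integral_smul hgm]
          rfl
  refine ⟨(∫⁻ h', ‖(c h' : ℝ) * |h'|‖ₑ).toNNReal, hmeas, hR.differentiable, ?_, ?_, ?_⟩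
  · intro x hx v y
    obtain ⟨hgm, hgc, hgd⟩ := (hg x hx v).1 y
    rw [ENNReal.coe_toNNReal hc.2.ne]
    calc _ = ∫⁻ h', ‖h'‖ₑ ∂((C.dens x v y : ℝ≥0∞) • (C.lawUH x (v, y)).map (M.partialH j x)) := by
          rw [lintegral_smul_measure, lintegral_map measurable_enorm (hmeas x hx), smul_eq_mul]
      _ = ∫⁻ h', (g x v y h' : ℝ≥0∞) * ‖h'‖ₑ := by
          rw [hgd, lintegral_withDensity_eq_lintegral_mul _ hgm.coe_nnreal_ennreal measurable_enorm]
          rfl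
      _ ≤ _ := by
          refine lintegral_mono fun h' => ?_
          have habs : ‖|h'|‖ₑ = ‖h'‖ₑ := by rw [← ofReal_norm, ← ofReal_norm, norm_abs_eq_norm]
          rw [enorm_mul, habs]
          gcongr
          simpa [enorm_eq_nnnorm] using hgc h'
  · intro x hx v y hd
    obtain ⟨hgm, hgc, hgd⟩ := (hg x hx v).1 y
    have h0 : ∀ᵐ h' ∂((C.dens x v y : ℝ≥0∞) • (C.lawUH x (v, y)).map (M.partialH j x)),
        h' ≠ 0 := by
      rw [hgd]
      exact (withDensity_absolutelyContinuous _ _).ae_le (Measure.ae_ne volume 0)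
    rw [Measure.ae_ennreal_smul_measure_iff (by simpa using hd)] at h0
    exact ae_of_ae_map (hmeas x hx).aemeasurable h0
  · intro x hx v k hk ht hb
    have hcont := (hg x hx v).2 k hk ht hb
    have hev : ∀ᶠ p : ℝ × ℝ in 𝓝 (x.1 j, (M.threshold v k).toReal),
        setComp x j p.1 ∈ M.interiorDir j :=
      (continuous_fst.tendsto (x.1 j, (M.threshold v k).toReal)).eventually
        (eventually_mem_interiorDir hx)
    have key : ContinuousAt (fun p : ℝ × ℝ => ∫ h', (g (setComp x j p.1) v p.2 h' : ℝ) * h')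
        (x.1 j, (M.threshold v k).toReal) := by
      refine continuousAt_of_dominated (bound := fun h' => (c h' : ℝ) * |h'|) ?_ ?_ hc ?_
      · filter_upwards [hev] with p hp
        exact (((hg _ hp v).1 p.2).1.coe_nnreal_real.mul measurable_id).aestronglyMeasurable
      · filter_upwards [hev] with p hp
        refine ae_of_all _ fun h' => ?_
        rw [norm_mul, Real.norm_eq_abs h', Real.norm_of_nonneg (NNReal.coe_nonneg _)]
        exact mul_le_mul_of_nonneg_right (by exact_mod_cast ((hg _ hp v).1 p.2).2.1 h')
          (abs_nonneg _)
      · filter_upwards [hcont] with h' hh'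
        exact (NNReal.continuous_coe.continuousAt.comp hh').mul continuousAt_const
    refine key.congr ?_
    filter_upwards [hev] with p hp
    exact (hslope _ hp v p.2).symm

section SlopeBound

variable {j : Fin J} {B : ℝ≥0} {x : Cov J K}

lemma SlopeBound.integrable_of_dens_ne_zero (hB : SlopeBound M C j B) (hx : x ∈ M.interiorDir j)
    {v : V} {y : ℝ} (hd : C.dens x v y ≠ 0) :
    Integrable (M.partialH j x) (C.lawUH x (v, y)) := by
  refine ⟨(hB.measurable_partialH x hx).aestronglyMeasurable, ?_⟩
  have := (hB.lintegral_le x hx v y).trans_lt ENNReal.coe_lt_top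
  exact ENNReal.lt_top_of_mul_ne_top_right this.ne (by simpa using hd)

lemma SlopeBound.abs_levelSlope_le (hB : SlopeBound M C j B) (hx : x ∈ M.interiorDir j)
    (v : V) (y : ℝ) : |levelSlope M C j x v y| ≤ B := by
  rw [← Real.norm_eq_abs, ← coe_nnnorm, NNReal.coe_le_coe, ← ENNReal.coe_le_coe,
    ← enorm_eq_nnnorm, levelSlope, enorm_mul]
  calc _ ≤ (C.dens x v y : ℝ≥0∞) * ∫⁻ u, ‖M.partialH j x u‖ₑ ∂(C.lawUH x (v, y)) := by
        gcongr
        · simp [enorm_eq_nnnorm]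
        · exact enorm_integral_le_lintegral_enorm _
    _ ≤ B := hB.lintegral_le x hx v y

lemma SlopeBound.measurable_levelSlope (hB : SlopeBound M C j B) (hx : x ∈ M.interiorDir j) :
    Measurable (fun p : V × ℝ => levelSlope M C j x p.1 p.2) :=
  (C.measurable_dens x).coe_nnreal_real.mul
    ((hB.measurable_partialH x hx).stronglyMeasurable.integral_kernel
      (κ := C.lawUH x)).measurable

variable {P : Measure Ω} {W : Ω → Fin K → ℝ} {Uvar : Ω → U} {Vvar : Ω → V}

/-- Disintegration of the law of `U` along the level sets of `h(x,·)`. -/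
lemma CondLaws.IsVersion.lintegral_eq (hC : C.IsVersion M P W Uvar Vvar) (hx : x ∈ M.X) (v : V)
    {F : ℝ × U → ℝ≥0∞} (hF : Measurable F) :
    ∫⁻ u, F (M.h x u, u) ∂(C.lawU (x.2, v)) =
      ∫⁻ y, C.dens x v y * ∫⁻ u, F (y, u) ∂(C.lawUH x (v, y)) := by
  have hdm : Measurable (fun y => (C.dens x v y : ℝ≥0∞)) :=
    ((C.measurable_dens x).comp measurable_prodMk_left).coe_nnreal_ennreal
  rw [← lintegral_map hF ((M.measurable_h_right x).prodMk measurable_id'), hC.condUH x hx v,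
    Measure.lintegral_compProd hF, lintegral_withDensity_eq_lintegral_mul _ hdm]
  · rfl
  · exact hF.lintegral_kernel_prod_right'

/-- A law with a density has no atoms. Hence the report made exactly at a threshold is irrelevant.
-/
lemma CondLaws.IsVersion.ae_ne (hC : C.IsVersion M P W Uvar Vvar) (hx : x ∈ M.X) (v : V) (y : ℝ) :
    ∀ᵐ u ∂(C.lawU (x.2, v)), M.h x u ≠ y := by
  have h0 : ∫⁻ u, ({y} ×ˢ Set.univ : Set (ℝ × U)).indicator 1 (M.h x u, u) ∂(C.lawU (x.2, v))
      = 0 := by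
    rw [hC.lintegral_eq hx v
      (measurable_one.indicator ((measurableSet_singleton y).prod MeasurableSet.univ))]
    refine (lintegral_congr_ae ?_).trans lintegral_zero
    filter_upwards [Measure.ae_ne volume y] with z hz
    simp [Set.indicator, hz]
  have hm : Measurable fun u => ({y} ×ˢ Set.univ : Set (ℝ × U)).indicator (1 : ℝ × U → ℝ≥0∞)
      (M.h x u, u) :=
    (measurable_one.indicator ((measurableSet_singleton y).prod MeasurableSet.univ)).comp
      ((M.measurable_h_right x).prodMk measurable_id')
  filter_upwards [(lintegral_eq_zero_iff hm).1 h0] with u hu hy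
  simp [Set.indicator, hy] at hu

lemma SlopeBound.lintegral_comp_mul_le (hB : SlopeBound M C j B)
    (hC : C.IsVersion M P W Uvar Vvar) (hx : x ∈ M.interiorDir j) (v : V) {q : ℝ → ℝ≥0∞}
    (hq : Measurable q) :
    ∫⁻ u, q (M.h x u) * ‖M.partialH j x u‖ₑ ∂(C.lawU (x.2, v)) ≤ B * ∫⁻ y, q y := by
  have hm := (hB.measurable_partialH x hx).enorm
  rw [hC.lintegral_eq (mem_of_mem_interiorDir hx) v (F := fun p => q p.1 * ‖M.partialH j x p.2‖ₑ)
    ((hq.comp measurable_fst).mul (hm.comp measurable_snd)), ← lintegral_const_mul _ hq]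
  refine lintegral_mono fun y => ?_
  simp only
  rw [lintegral_const_mul _ hm, mul_left_comm, mul_comm (B : ℝ≥0∞)]
  exact mul_le_mul_right (hB.lintegral_le x hx v y) _

/-- Conditioning on the latent level pulls `q` out of the inner integral. With
`SlopeBound.lintegral_comp_mul_le`, this shows that `levelSlope` can serve as the function `m` of
`abs_measureReal_gt_sub_sub_le`. -/
lemma SlopeBound.integral_comp_mul (hB : SlopeBound M C j B)
    (hC : C.IsVersion M P W Uvar Vvar) (hx : x ∈ M.interiorDir j) (v : V) {q : ℝ → ℝ}
    (hq : Measurable q) (hqi : Integrable q) :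
    ∫ u, q (M.h x u) * M.partialH j x u ∂(C.lawU (x.2, v)) =
      ∫ y, q y * levelSlope M C j x v y := by
  have hpair : Measurable fun u => (M.h x u, u) := (M.measurable_h_right x).prodMk measurable_id'
  have hFm : Measurable fun p : ℝ × U => q p.1 * M.partialH j x p.2 :=
    (hq.comp measurable_fst).mul ((hB.measurable_partialH x hx).comp measurable_snd)
  have hdm : Measurable (fun y => C.dens x v y) :=
    (C.measurable_dens x).comp measurable_prodMk_left
  have hint : Integrable (fun p : ℝ × U => q p.1 * M.partialH j x p.2)
      ((C.lawU (x.2, v)).map fun u => (M.h x u, u)) := by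
    rw [integrable_map_measure hFm.aestronglyMeasurable hpair.aemeasurable]
    refine ⟨(hFm.comp hpair).aestronglyMeasurable, ?_⟩
    simp only [HasFiniteIntegral, Function.comp_apply, enorm_mul]
    exact (hB.lintegral_comp_mul_le hC hx v hq.enorm).trans_lt
      (ENNReal.mul_lt_top ENNReal.coe_lt_top hqi.2)
  have h1 := integral_map hpair.aemeasurable hFm.aestronglyMeasurable
    (μ := C.lawU (x.2, v))
  simp only at h1
  rw [← h1]
  rw [hC.condUH x (mem_of_mem_interiorDir hx) v] at hint ⊢
  rw [Measure.integral_compProd hint, integral_withDensity_eq_integral_smul hdm]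
  refine integral_congr_ae (ae_of_all _ fun y => ?_)
  simp only [integral_const_mul, NNReal.smul_def, smul_eq_mul, levelSlope, Kernel.comap_apply]
  ring

variable (M C) in
/-- The probability, given `x` and `v`, that the latent variable exceeds `y`. -/
noncomputable def exceedance (x : Cov J K) (v : V) (y : ℝ) : ℝ :=
  (C.lawU (x.2, v)).real {u | y < M.h x u}

lemma SlopeBound.abs_exceedance_sub_sub_le (hB : SlopeBound M C j B)
    (hC : C.IsVersion M P W Uvar Vvar) (v : V) {a b : ℝ}
    (hab : ∀ s ∈ Set.uIcc a b, setComp x j s ∈ M.interiorDir j)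
    {y₀ δ L ε : ℝ} (hδ : 0 < δ)
    (hL : ∀ s ∈ Set.uIcc a b, ∀ y ∈ Set.Icc y₀ (y₀ + δ),
      |levelSlope M C j (setComp x j s) v y - L| ≤ ε) :
    |exceedance M C (setComp x j b) v y₀ - exceedance M C (setComp x j a) v y₀ - L * (b - a)| ≤
      ε * |b - a| := by
  refine abs_measureReal_gt_sub_sub_le (ρ := C.lawU (x.2, v)) (c := B)
    (φ := fun s u => M.h (setComp x j s) u)
    (m := fun s y => levelSlope M C j (setComp x j s) v y)
    (M.measurable_h_setComp x j) (fun s hs u => ?_) ENNReal.coe_ne_top (fun s hs => ?_)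
    (fun s hs q hq => ?_) (fun s hs q hq hqi => ?_) hδ hL
  · simpa using hB.differentiable _ (hab s hs) u
  · exact (hB.measurable_levelSlope (hab s hs)).comp measurable_prodMk_left
  · simpa only [M.partialH_setComp, setComp_snd] using hB.lintegral_comp_mul_le hC (hab s hs) v hq
  · simpa only [M.partialH_setComp, setComp_snd] using hB.integral_comp_mul hC (hab s hs) v hq hqi

lemma SlopeBound.abs_exceedance_sub_le (hB : SlopeBound M C j B)
    (hC : C.IsVersion M P W Uvar Vvar) (v : V) {a b : ℝ}
    (hab : ∀ s ∈ Set.uIcc a b, setComp x j s ∈ M.interiorDir j) (y₀ : ℝ) :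
    |exceedance M C (setComp x j b) v y₀ - exceedance M C (setComp x j a) v y₀| ≤
      B * |b - a| := by
  -- The slope bound is global in `y`, so any `δ` serves; taking `L = 0` turns the mean value
  -- inequality into a Lipschitz bound.
  simpa using hB.abs_exceedance_sub_sub_le hC v hab (y₀ := y₀) (δ := 1) (L := 0) (ε := B) one_pos
    (fun s hs y _ => by simpa using hB.abs_levelSlope_le (hab s hs) v y)

lemma SlopeBound.hasDerivAt_exceedance (hB : SlopeBound M C j B)
    (hC : C.IsVersion M P W Uvar Vvar) (hx : x ∈ M.interiorDir j) (v : V) {y₀ : ℝ}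
    (hcont : ContinuousAt (fun p : ℝ × ℝ => levelSlope M C j (setComp x j p.1) v p.2)
      (x.1 j, y₀)) :
    HasDerivAt (fun s => exceedance M C (setComp x j s) v y₀) (levelSlope M C j x v y₀)
      (x.1 j) := by
  rw [hasDerivAt_iff_isLittleO, Asymptotics.isLittleO_iff]
  intro ε hε
  rw [Metric.continuousAt_iff] at hcont
  obtain ⟨δ, hδ, hδc⟩ := hcont ε hε
  obtain ⟨η, hη, hηi⟩ := Metric.eventually_nhds_iff.1 (eventually_mem_interiorDir hx)
  filter_upwards [Metric.ball_mem_nhds (x.1 j) (lt_min hδ hη)] with b hb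
  have hb' : ∀ s ∈ Set.uIcc (x.1 j) b, dist s (x.1 j) < min δ η := fun s hs =>
    lt_of_le_of_lt (by simpa [Real.dist_eq] using Set.abs_sub_left_of_mem_uIcc hs) hb
  -- Joint continuity controls the slope for all parameters up to `b` and all levels just above `y₀`
  -- at once; `δ / 2` keeps the closed interval of levels inside the open ball.
  have := hB.abs_exceedance_sub_sub_le hC v (x := x) (a := x.1 j) (b := b) (y₀ := y₀)
    (L := levelSlope M C j x v y₀) (ε := ε) (δ := δ / 2)
    (fun s hs => hηi ((hb' s hs).trans_le (min_le_right _ _))) (half_pos hδ) ?_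
  · simpa [mul_comm] using this
  · intro s hs y hy
    have h2 := @hδc (s, y) (by
      rw [Prod.dist_eq, max_lt_iff]
      refine ⟨(hb' s hs).trans_le (min_le_left _ _), ?_⟩
      rw [Real.dist_eq, abs_of_nonneg (by linarith [hy.1])]
      linarith [hy.2])
    rw [Real.dist_eq] at h2
    simpa using h2.le

end SlopeBound

end Reporting

/-! ### Thresholds: measurability, and the laws conditional on being at one. -/

/-- Every set of reals has a countable subset that approximates each of its points from the left. -/
lemma Set.exists_countable_subset_forall_mem_Ioc (H : Set ℝ) :
    ∃ D ⊆ H, D.Countable ∧ ∀ y ∈ H, ∀ a < y, ∃ d ∈ D, a < d ∧ d ≤ y := by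
  obtain ⟨D, hDH, hDc, hD⟩ :=
    (TopologicalSpace.IsSeparable.of_separableSpace H).exists_countable_dense_subset
  -- A dense subset may fail at points of `H` isolated from the left; these are countably many and
  -- are added.
  refine ⟨D ∪ {x ∈ H | 𝓝[H ∩ Iio x] x = ⊥}, union_subset hDH (fun x hx => hx.1),
    hDc.union countable_setOfPred_isolated_left_within, fun y hy a ha => ?_⟩
  by_cases hiso : 𝓝[H ∩ Iio y] y = ⊥
  · exact ⟨y, Or.inr ⟨hy, hiso⟩, ha, le_rfl⟩
  · have : (𝓝[H ∩ Iio y] y).NeBot := ⟨hiso⟩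
    obtain ⟨z, ⟨hzH, hzy⟩, haz⟩ := ((eventually_mem_nhdsWithin (a := y) (s := H ∩ Iio y)).and
      (mem_nhdsWithin_of_mem_nhds (Ioi_mem_nhds ha))).exists
    obtain ⟨d, hd, hdD⟩ := mem_closure_iff_nhds.1 (hD hzH) _ (Ioo_mem_nhds haz hzy)
    exact ⟨d, Or.inl hdD, hd.1, hd.2.le⟩

namespace Reporting

variable {J K : ℕ} {U V : Type*} [MeasurableSpace U] [MeasurableSpace V]
  {M : Model J K U V}

/-- Monotonicity makes `{r ≤ k}` a lower set in `H`, so approximating its points from the left stays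
inside it, and the supremum can be taken over a countable set independent of `v`. -/
lemma Model.Honest.measurable_threshold (hM : M.Honest) (k : ℕ) :
    Measurable fun v => M.threshold v k := by
  classical
  obtain ⟨D, hDH, hDc, hD⟩ := M.H.exists_countable_subset_forall_mem_Ioc
  have e : (fun v => M.threshold v k) =
      fun v => ⨆ d ∈ D, if M.r d v ≤ k then (d : EReal) else ⊥ := by
    ext v
    refine le_antisymm (sSup_le ?_) (iSup₂_le fun d hd => ?_)
    · rintro _ ⟨y, ⟨hy, hyk⟩, rfl⟩
      refine le_of_forall_lt fun a ha => ?_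
      obtain ⟨b, hab, hby⟩ := EReal.lt_iff_exists_real_btwn.1 ha
      obtain ⟨d, hd, hbd, hdy⟩ := hD y hy b (EReal.coe_lt_coe_iff.1 hby)
      have hdk : M.r d v ≤ k := ((hM v).1 (hDH hd) hy hdy).trans hyk
      refine hab.trans ((EReal.coe_lt_coe_iff.2 hbd).trans_le ?_)
      refine le_trans ?_ (le_iSup₂ (f := fun d (_ : d ∈ D) =>
        if M.r d v ≤ k then (d : EReal) else ⊥) d hd)
      simp [hdk]
    · split_ifs with h
      · exact le_sSup ⟨d, ⟨hDH hd, h⟩, rfl⟩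
      · exact bot_le
  rw [e]
  refine Measurable.biSup D hDc fun d _ => Measurable.ite ?_ measurable_const measurable_const
  exact (M.measurable_r.comp (measurable_prodMk_left (x := d))) measurableSet_Iic

lemma Model.Honest.threshold_le_of_lt (hM : M.Honest) {v : V} {k : ℕ} {y : ℝ} (hy : y ∈ M.H)
    (h : k < M.r y v) : M.threshold v k ≤ y := by
  refine sSup_le ?_
  rintro _ ⟨z, ⟨hz, hzk⟩, rfl⟩
  by_contra! hlt
  exact absurd ((hM v).1 hy hz (EReal.coe_lt_coe_iff.1 hlt).le) (by simp only; omega)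

lemma Model.le_threshold {v : V} {k : ℕ} {y : ℝ} (hy : y ∈ M.H) (h : M.r y v ≤ k) :
    (y : EReal) ≤ M.threshold v k :=
  le_sSup ⟨y, ⟨hy, h⟩, rfl⟩

variable {C : CondLaws J K U V} {x : Cov J K}

lemma Model.Honest.measurable_thresholdDens (hM : M.Honest) (k : ℕ) :
    Measurable fun v => thresholdDens M C x v k := by
  classical
  have hτ := hM.measurable_threshold k
  unfold thresholdDens
  refine Measurable.ite ((hτ (measurableSet_singleton ⊤)).union (hτ (measurableSet_singleton ⊥)))
    measurable_const ((C.measurable_dens x).comp (measurable_id.prodMk hτ.ereal_toReal))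

lemma Model.Honest.measurable_weight (hM : M.Honest) : Measurable fun v => weight M C x v :=
  Finset.measurable_sum _ fun k _ => hM.measurable_thresholdDens k

lemma Model.Honest.measurable_thresholdLaw (hM : M.Honest) : Measurable (thresholdLaw M C x) := by
  refine Measure.measurable_of_measurable_coe _ fun s hs => ?_
  simp only [thresholdLaw, Measure.coe_finsetSum, Finset.sum_apply, Measure.smul_apply,
    smul_eq_mul]
  refine Finset.measurable_sum _ fun k _ => Measurable.mul ?_ ?_
  · exact ((hM.measurable_thresholdDens k).div hM.measurable_weight).coe_nnreal_ennreal
  · exact (Kernel.measurable_coe _ hs).comp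
      (measurable_id.prodMk (hM.measurable_threshold k).ereal_toReal)

variable (C x) in
/-- `thresholdLaw` as a kernel. -/
noncomputable def Model.Honest.thresholdKernel (hM : M.Honest) : Kernel V U :=
  ⟨thresholdLaw M C x, hM.measurable_thresholdLaw⟩

/-- The weight cancels the normalisation. At weight zero the identity survives because each summand
of the weight is then zero. -/
lemma lintegral_thresholdLaw (v : V) (f : U → ℝ≥0∞) :
    (weight M C x v : ℝ≥0∞) * ∫⁻ u, f u ∂(thresholdLaw M C x v) =
      ∑ k ∈ Finset.range M.Rbar, (thresholdDens M C x v k : ℝ≥0∞) *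
        ∫⁻ u, f u ∂(C.lawUH x (v, (M.threshold v k).toReal)) := by
  rw [thresholdLaw, lintegral_finsetSum_measure, Finset.mul_sum]
  refine Finset.sum_congr rfl fun k hk => ?_
  rw [lintegral_smul_measure, smul_eq_mul, ← mul_assoc, ← ENNReal.coe_mul]
  congr 2
  by_cases hw : weight M C x v = 0
  · have := (Finset.sum_eq_zero_iff.1 hw) k hk
    simp [hw, this]
  · rw [mul_div_cancel₀ _ hw]

lemma integral_thresholdLaw (v : V) (f : U → ℝ)
    (hf : ∀ k < M.Rbar, thresholdDens M C x v k ≠ 0 →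
      Integrable f (C.lawUH x (v, (M.threshold v k).toReal))) :
    (weight M C x v : ℝ) * ∫ u, f u ∂(thresholdLaw M C x v) =
      ∑ k ∈ Finset.range M.Rbar, (thresholdDens M C x v k : ℝ) *
        ∫ u, f u ∂(C.lawUH x (v, (M.threshold v k).toReal)) := by
  rw [thresholdLaw, integral_finsetSum_measure, Finset.mul_sum]
  · refine Finset.sum_congr rfl fun k hk => ?_
    rw [integral_smul_measure, smul_eq_mul, ← mul_assoc, ENNReal.coe_toReal, ← NNReal.coe_mul]
    congr 2
    by_cases hw : weight M C x v = 0
    · have := (Finset.sum_eq_zero_iff.1 hw) k hk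
      simp [hw, this]
    · rw [mul_div_cancel₀ _ hw]
  · intro k hk
    by_cases h0 : thresholdDens M C x v k = 0
    · simp [h0]
    · exact (hf k (Finset.mem_range.1 hk) h0).smul_measure ENNReal.coe_ne_top

lemma thresholdLaw_univ {v : V} (hw : 0 < weight M C x v) : thresholdLaw M C x v Set.univ = 1 := by
  have := lintegral_thresholdLaw (M := M) (C := C) (x := x) v 1
  simp only [Pi.one_apply, lintegral_one, measure_univ, mul_one] at this
  rw [← ENNReal.ofNNReal_finsetSum, ← weight] at this
  have h0 : (weight M C x v : ℝ≥0∞) ≠ 0 := by simpa using hw.ne'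
  exact (ENNReal.mul_eq_left h0 ENNReal.coe_ne_top).1 this

instance (hM : M.Honest) : IsFiniteKernel (hM.thresholdKernel C x) := by
  refine ⟨1, ENNReal.one_lt_top, fun v => ?_⟩
  change thresholdLaw M C x v Set.univ ≤ 1
  rcases eq_zero_or_pos (weight M C x v) with hw | hw
  -- Division by zero yields zero, so the law is the zero measure here rather than a probability.
  · simp [thresholdLaw, hw]
  · exact (thresholdLaw_univ hw).le

/-- This form makes Fubini for `⊗ₘ` available. -/
lemma Model.Honest.localLaw_eq (hM : M.Honest)
    [SFinite (ProbabilityTheory.cond (C.lawV x.2) {v | 0 < weight M C x v})] :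
    localLaw M C x =
      ProbabilityTheory.cond (C.lawV x.2) {v | 0 < weight M C x v} ⊗ₘ hM.thresholdKernel C x := by
  have hmap : ∀ s : Set (V × U), MeasurableSet s → ∀ v,
      ((thresholdLaw M C x v).map (Prod.mk v)) s = hM.thresholdKernel C x v (Prod.mk v ⁻¹' s) :=
    fun s hs v => Measure.map_apply measurable_prodMk_left hs
  ext s hs
  rw [localLaw, Measure.bind_apply hs, Measure.compProd_apply hs]
  · exact lintegral_congr fun v => hmap s hs v
  · refine (Measure.measurable_of_measurable_coe _ fun s hs => ?_).aemeasurable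
    simp only [hmap s hs]
    exact Kernel.measurable_kernel_prodMk_left hs

end Reporting

/-! ### Differentiating the regression function. -/

namespace Reporting

variable {J K : ℕ} {U V Ω : Type*} [MeasurableSpace U] [MeasurableSpace V] [MeasurableSpace Ω]
  {M : Model J K U V} {C : CondLaws J K U V}

variable (M C) in
/-- The probability, given `x` and `v`, of a response above `k`. -/
noncomputable def responseTail (x : Cov J K) (v : V) (k : ℕ) : ℝ :=
  (C.lawU (x.2, v)).real {u | k < M.r (M.h x u) v}

lemma Model.measurable_r_h (M : Model J K U V) (x : Cov J K) (v : V) :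
    Measurable fun u => M.r (M.h x u) v :=
  M.measurable_r.comp ((M.measurable_h_right x).prodMk measurable_const)

/-- Layer-cake formula: an integer in `{0, …, Rbar}` is the number of `k < Rbar` strictly below it.
-/
lemma integral_response_eq_sum_responseTail {x : Cov J K} (hx : x ∈ M.X) (v : V) :
    ∫ u, (M.r (M.h x u) v : ℝ) ∂(C.lawU (x.2, v)) =
      ∑ k ∈ Finset.range M.Rbar, responseTail M C x v k := by
  have hset : ∀ k, MeasurableSet {u | k < M.r (M.h x u) v} := fun k =>
    M.measurable_r_h x v measurableSet_Ioi
  have hpt : ∀ u, (M.r (M.h x u) v : ℝ) =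
      ∑ k ∈ Finset.range M.Rbar, {u | k < M.r (M.h x u) v}.indicator (1 : U → ℝ) u := by
    intro u
    have hle := M.r_le _ (M.h_mem x hx u) v
    have hfil : (Finset.range M.Rbar).filter (fun k => k < M.r (M.h x u) v) =
        Finset.range (M.r (M.h x u) v) := by
      ext k; simp only [Finset.mem_filter, Finset.mem_range]; omega
    simp [Set.indicator_apply, Finset.sum_boole, hfil]
  simp_rw [hpt]
  refine (integral_finsetSum _ fun k _ => (integrable_const (1 : ℝ)).indicator (hset k)).trans ?_
  exact Finset.sum_congr rfl fun k _ => integral_indicator_one (hset k)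

/-- At an infinite threshold the tail does not vary with `x`, so its derivative is zero, in
agreement with `thresholdDens` being zero there. -/
lemma Model.Honest.responseTail_of_threshold_eq_top (hM : M.Honest) {x : Cov J K} (hx : x ∈ M.X)
    {v : V} {k : ℕ} (h : M.threshold v k = ⊤) : responseTail M C x v k = 0 := by
  have : {u | k < M.r (M.h x u) v} = ∅ := Set.eq_empty_iff_forall_notMem.2 fun u hu => by
    have := hM.threshold_le_of_lt (M.h_mem x hx u) hu
    rw [h, top_le_iff] at this
    exact EReal.coe_ne_top _ this
  simp [responseTail, this]

lemma responseTail_of_threshold_eq_bot {x : Cov J K} (hx : x ∈ M.X)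
    {v : V} {k : ℕ} (h : M.threshold v k = ⊥) : responseTail M C x v k = 1 := by
  have : {u | k < M.r (M.h x u) v} = Set.univ := Set.eq_univ_iff_forall.2 fun u => by
    by_contra hu
    have := M.le_threshold (M.h_mem x hx u) (not_lt.1 hu)
    rw [h, le_bot_iff] at this
    exact EReal.coe_ne_bot _ this
  simp [responseTail, this]

variable {P : Measure Ω} {W : Ω → Fin K → ℝ} {Uvar : Ω → U} {Vvar : Ω → V}

/-- Monotonicity makes the two events agree except where the latent variable equals the threshold,
which is a null event. -/
lemma Model.Honest.responseTail_eq_exceedance (hM : M.Honest)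
    (hC : C.IsVersion M P W Uvar Vvar) {x : Cov J K} (hx : x ∈ M.X)
    {v : V} {k : ℕ} (ht : M.threshold v k ≠ ⊤) (hb : M.threshold v k ≠ ⊥) :
    responseTail M C x v k = exceedance M C x v (M.threshold v k).toReal := by
  refine measureReal_congr ?_
  filter_upwards [hC.ae_ne hx v (M.threshold v k).toReal] with u hu
  have hcoe := EReal.coe_toReal ht hb
  refine propext ⟨fun h => ?_, fun h => ?_⟩
  · have := hM.threshold_le_of_lt (M.h_mem x hx u) h
    rw [← hcoe, EReal.coe_le_coe_iff] at this
    exact lt_of_le_of_ne this (Ne.symm hu)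
  · by_contra hle
    have := M.le_threshold (M.h_mem x hx u) (not_lt.1 hle)
    rw [← hcoe, EReal.coe_le_coe_iff] at this
    exact absurd h (not_lt.2 this)

variable (M C) in
/-- The derivative with respect to `x_j` of the mean response given `x` and `v`. -/
noncomputable def responseSlope (j : Fin J) (x : Cov J K) (v : V) : ℝ :=
  ∑ k ∈ Finset.range M.Rbar, (thresholdDens M C x v k : ℝ) *
    ∫ u, M.partialH j x u ∂(C.lawUH x (v, (M.threshold v k).toReal))

variable {j : Fin J} {B : ℝ≥0} {x : Cov J K}

lemma SlopeBound.measurable_responseSlope (hB : SlopeBound M C j B) (hM : M.Honest)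
    (hx : x ∈ M.interiorDir j) : Measurable (responseSlope M C j x) := by
  refine Finset.measurable_sum _ fun k _ =>
    (hM.measurable_thresholdDens k).coe_nnreal_real.mul ?_
  exact ((hB.measurable_partialH x hx).stronglyMeasurable.integral_kernel
    (κ := C.lawUH x)).measurable.comp (measurable_id.prodMk (hM.measurable_threshold k).ereal_toReal)

lemma SlopeBound.hasDerivAt_responseTail (hB : SlopeBound M C j B) (hM : M.Honest)
    (hC : C.IsVersion M P W Uvar Vvar) (hx : x ∈ M.interiorDir j) (v : V) {k : ℕ}
    (hk : k < M.Rbar) :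
    HasDerivAt (fun s => responseTail M C (setComp x j s) v k)
      (thresholdDens M C x v k * ∫ u, M.partialH j x u ∂(C.lawUH x (v, (M.threshold v k).toReal)))
      (x.1 j) := by
  have hX : ∀ᶠ s in 𝓝 (x.1 j), setComp x j s ∈ M.X := hx
  by_cases ht : M.threshold v k = ⊤
  · have h0 : thresholdDens M C x v k = 0 := by simp [thresholdDens, ht]
    rw [h0, NNReal.coe_zero, zero_mul]
    refine (hasDerivAt_const (x.1 j) (0 : ℝ)).congr_of_eventuallyEq ?_
    filter_upwards [hX] with s hs using hM.responseTail_of_threshold_eq_top hs ht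
  by_cases hb : M.threshold v k = ⊥
  · have h0 : thresholdDens M C x v k = 0 := by simp [thresholdDens, hb]
    rw [h0, NNReal.coe_zero, zero_mul]
    refine (hasDerivAt_const (x.1 j) (1 : ℝ)).congr_of_eventuallyEq ?_
    filter_upwards [hX] with s hs using responseTail_of_threshold_eq_bot hs hb
  have h1 : thresholdDens M C x v k = C.dens x v (M.threshold v k).toReal := by
    simp [thresholdDens, ht, hb]
  rw [h1]
  refine (hB.hasDerivAt_exceedance hC hx v
    (hB.continuousAt x hx v k hk ht hb)).congr_of_eventuallyEq ?_
  filter_upwards [hX] with s hs using hM.responseTail_eq_exceedance hC hs ht hb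

lemma SlopeBound.abs_responseTail_sub_le (hB : SlopeBound M C j B) (hM : M.Honest)
    (hC : C.IsVersion M P W Uvar Vvar) (v : V) (k : ℕ) {a b : ℝ}
    (hab : ∀ s ∈ Set.uIcc a b, setComp x j s ∈ M.interiorDir j) :
    |responseTail M C (setComp x j b) v k - responseTail M C (setComp x j a) v k| ≤
      B * |b - a| := by
  have ha := mem_of_mem_interiorDir (hab a Set.left_mem_uIcc)
  have hb := mem_of_mem_interiorDir (hab b Set.right_mem_uIcc)
  have h0 : 0 ≤ B * |b - a| := by positivity
  by_cases ht : M.threshold v k = ⊤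
  · simpa [hM.responseTail_of_threshold_eq_top ha ht, hM.responseTail_of_threshold_eq_top hb ht]
  by_cases hbot : M.threshold v k = ⊥
  · simpa [responseTail_of_threshold_eq_bot ha hbot, responseTail_of_threshold_eq_bot hb hbot]
  rw [hM.responseTail_eq_exceedance hC ha ht hbot, hM.responseTail_eq_exceedance hC hb ht hbot]
  exact hB.abs_exceedance_sub_le hC v hab _

/-- Differentiation of the regression function under the distribution of `V`. -/
theorem SlopeBound.hasDerivAt_regression (hB : SlopeBound M C j B) (hM : M.Honest)
    (hC : C.IsVersion M P W Uvar Vvar) (hx : x ∈ M.interiorDir j) :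
    HasDerivAt (fun s => regression M C (setComp x j s))
      (∫ v, responseSlope M C j x v ∂(C.lawV x.2)) (x.1 j) := by
  obtain ⟨η, hη, hηi⟩ := Metric.eventually_nhds_iff_ball.1 (eventually_mem_interiorDir hx)
  have hmem : ∀ s ∈ Metric.ball (x.1 j) η, setComp x j s ∈ M.X := fun s hs =>
    mem_of_mem_interiorDir (hηi s hs)
  have hball := Metric.ball_mem_nhds (x.1 j) hη
  set F : ℝ → V → ℝ := fun s v => ∫ u, (M.r (M.h (setComp x j s) u) v : ℝ) ∂(C.lawU (x.2, v))
    with hF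
  have hFeq : ∀ s ∈ Metric.ball (x.1 j) η, ∀ v,
      F s v = ∑ k ∈ Finset.range M.Rbar, responseTail M C (setComp x j s) v k := fun s hs v =>
    integral_response_eq_sum_responseTail (hmem s hs) v
  have hFm : ∀ s, StronglyMeasurable (F s) := by
    intro s
    have h1 : StronglyMeasurable fun p : V × U => (M.r (M.h (setComp x j s) p.2) p.1 : ℝ) :=
      (M.measurable_response.comp (measurable_const.prodMk measurable_id)).stronglyMeasurable
    exact h1.integral_kernel_prod_right'' (η := C.lawU)
  have hFi : Integrable (F (x.1 j)) (C.lawV x.2) := by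
    refine Integrable.of_bound (C := M.Rbar) (hFm _).aestronglyMeasurable (ae_of_all _ fun v => ?_)
    refine (norm_integral_le_of_norm_le_const (C := M.Rbar) (ae_of_all _ fun u => ?_)).trans ?_
    · simpa using M.r_le _ (M.h_mem x (mem_of_mem_interiorDir hx) u) v
    · simp
  -- Each of the `Rbar` tails is `B`-Lipschitz near `x_j`, uniformly in `v`; a constant therefore
  -- dominates.
  refine (hasDerivAt_integral_of_dominated_loc_of_lip (F := F) (bound := fun _ => M.Rbar * B)
    hball (Eventually.of_forall fun s => (hFm s).aestronglyMeasurable) hFi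
    (hB.measurable_responseSlope hM hx).aestronglyMeasurable (ae_of_all _ fun v => ?_)
    (integrable_const _) (ae_of_all _ fun v => ?_)).2
  · refine LipschitzOnWith.of_dist_le_mul fun b hb a ha => ?_
    have hab : ∀ s ∈ Set.uIcc a b, setComp x j s ∈ M.interiorDir j := fun s hs =>
      hηi s ((convex_ball (x.1 j) η).ordConnected.uIcc_subset ha hb hs)
    have habs : ((Real.nnabs (M.Rbar * B) : ℝ≥0) : ℝ) = M.Rbar * B := by
      rw [Real.coe_nnabs, abs_of_nonneg (by positivity)]
    rw [Real.dist_eq, Real.dist_eq, habs, hFeq b hb, hFeq a ha, ← Finset.sum_sub_distrib]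
    calc _ ≤ ∑ k ∈ Finset.range M.Rbar, |responseTail M C (setComp x j b) v k -
            responseTail M C (setComp x j a) v k| := Finset.abs_sum_le_sum_abs _ _
      _ ≤ ∑ k ∈ Finset.range M.Rbar, (B : ℝ) * |b - a| :=
          Finset.sum_le_sum fun k _ => hB.abs_responseTail_sub_le hM hC v k hab
      _ = M.Rbar * B * |b - a| := by simp [mul_assoc]
  · refine (HasDerivAt.fun_sum fun k hk => hB.hasDerivAt_responseTail hM hC hx v
      (Finset.mem_range.1 hk)).congr_of_eventuallyEq ?_
    filter_upwards [hball] with s hs using hFeq s hs v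

end Reporting

/-! ### The covariance identity. -/

namespace ProbabilityTheory

/-- If the weight `w` is independent of `(D₁, D₂)`, the weighted means of `D₁` and `D₂` are
proportional to their means, which determine the covariance of `D₁ / D₂` and `D₂`. -/
lemma IndepFun.covariance_div_left {Ω : Type*} {mΩ : MeasurableSpace Ω} {L : Measure Ω}
    [IsProbabilityMeasure L] {w D₁ D₂ : Ω → ℝ} (hw : 0 ≤ w)
    (hwm : Measurable w) (hm₁ : Measurable D₁) (hm₂ : Measurable D₂)
    (hi₁ : IndepFun w D₁ L) (hi₂ : IndepFun w D₂ L)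
    (hI₁ : Integrable (fun p => w p * D₁ p) L) (hD₂ : ∀ᵐ p ∂L, D₂ p ≠ 0)
    (hratio : Integrable (fun p => D₁ p / D₂ p) L) (hne : ∫ p, w p * D₂ p ∂L ≠ 0) :
    ∃ t > 0, ∫ p, w p * D₁ p ∂L = t * ∫ p, D₁ p ∂L ∧ ∫ p, w p * D₂ p ∂L = t * ∫ p, D₂ p ∂L ∧
      cov[fun p => D₁ p / D₂ p, D₂; L] =
        ∫ p, D₁ p ∂L - (∫ p, D₁ p / D₂ p ∂L) * ∫ p, D₂ p ∂L := by
  have h₁ := hi₁.integral_fun_mul_eq_mul_integral hwm.aestronglyMeasurable hm₁.aestronglyMeasurable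
  have h₂ := hi₂.integral_fun_mul_eq_mul_integral hwm.aestronglyMeasurable hm₂.aestronglyMeasurable
  rw [h₂] at hne
  have hw0 : ∫ p, w p ∂L ≠ 0 := left_ne_zero_of_mul hne
  have hD20 : ∫ p, D₂ p ∂L ≠ 0 := right_ne_zero_of_mul hne
  -- The Bochner integral of a non-integrable function is zero, so a nonzero integral forces
  -- integrability.
  have hID₂ : Integrable D₂ L := not_imp_comm.1 integral_undef hD20
  -- By independence, integrability of `w D₁` passes to `D₁` as soon as `w` is not almost surely
  -- zero.
  have hID₁ : Integrable D₁ L :=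
    hi₁.integrable_right_of_integrable_op (· * ·) 1 one_ne_zero (by simp [enorm_mul]) hI₁
      hwm.aestronglyMeasurable hm₁.aestronglyMeasurable fun h => hw0 (integral_eq_zero_of_ae h)
  refine ⟨∫ p, w p ∂L, (integral_nonneg hw).lt_of_ne' hw0, h₁, h₂, ?_⟩
  set r := ∫ p, D₁ p / D₂ p ∂L with hr
  set d := ∫ p, D₂ p ∂L with hd
  -- Where `D₂ ≠ 0`, the product of the ratio with `D₂` is `D₁`; each remaining term is integrable
  -- on its own.
  have hprod : (fun p => (D₁ p / D₂ p - r) * (D₂ p - d)) =ᵐ[L]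
      fun p => D₁ p - d * (D₁ p / D₂ p) - (r * D₂ p - r * d) := by
    filter_upwards [hD₂] with p hp
    field_simp
  have hi₃ : Integrable (fun p => D₁ p - d * (D₁ p / D₂ p)) L := hID₁.sub (hratio.const_mul d)
  have hi₄ : Integrable (fun p => r * D₂ p - r * d) L :=
    (hID₂.const_mul r).sub (integrable_const _)
  rw [covariance, integral_congr_ae hprod, integral_sub hi₃ hi₄,
    integral_sub hID₁ (hratio.const_mul d), integral_sub (hID₂.const_mul r) (integrable_const _),
    integral_const_mul, integral_const_mul, ← hr, ← hd, integral_const, probReal_univ, one_smul]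
  ring

end ProbabilityTheory

/-! ### Partial effects as local means. -/

namespace Reporting

variable {J K : ℕ} {U V : Type*} [MeasurableSpace U] [MeasurableSpace V]
  {M : Model J K U V} {C : CondLaws J K U V} {j : Fin J} {B : ℝ≥0} {x : Cov J K}

lemma dens_ne_zero_of_thresholdDens_ne_zero {v : V} {k : ℕ} (h : thresholdDens M C x v k ≠ 0) :
    C.dens x v (M.threshold v k).toReal ≠ 0 := by
  unfold thresholdDens at h
  split_ifs at h
  · exact absurd rfl h
  · exact h

lemma SlopeBound.thresholdDens_mul_le (hB : SlopeBound M C j B) (hx : x ∈ M.interiorDir j) (v : V)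
    (k : ℕ) : (thresholdDens M C x v k : ℝ≥0∞) *
      ∫⁻ u, ‖M.partialH j x u‖ₑ ∂(C.lawUH x (v, (M.threshold v k).toReal)) ≤ B := by
  unfold thresholdDens
  split_ifs
  · simp
  · exact hB.lintegral_le x hx v _

lemma SlopeBound.responseSlope_eq (hB : SlopeBound M C j B) (hx : x ∈ M.interiorDir j) (v : V) :
    responseSlope M C j x v = weight M C x v * ∫ u, M.partialH j x u ∂(thresholdLaw M C x v) :=
  (integral_thresholdLaw v _ fun _ _ hk =>
    hB.integrable_of_dens_ne_zero hx (dens_ne_zero_of_thresholdDens_ne_zero hk)).symm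

lemma SlopeBound.ae_thresholdLaw_ne_zero (hB : SlopeBound M C j B) (hx : x ∈ M.interiorDir j)
    (v : V) : ∀ᵐ u ∂(thresholdLaw M C x v), M.partialH j x u ≠ 0 := by
  rw [thresholdLaw, ae_finsetSum_measure_iff]
  intro k _
  by_cases h : thresholdDens M C x v k = 0
  · simp [h]
  · exact Measure.ae_smul_measure
      (hB.ae_ne_zero x hx v _ (dens_ne_zero_of_thresholdDens_ne_zero h)) _

/-- The slope vanishes where the weight does, so conditioning on positive weight only rescales the
integral. -/
lemma integral_responseSlope_eq_mul (hB : SlopeBound M C j B)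
    (hx : x ∈ M.interiorDir j) :
    ∫ v, responseSlope M C j x v ∂(C.lawV x.2) =
      (C.lawV x.2).real {v | 0 < weight M C x v} *
        ∫ v, responseSlope M C j x v
          ∂(ProbabilityTheory.cond (C.lawV x.2) {v | 0 < weight M C x v}) := by
  set A := {v | 0 < weight M C x v} with hA
  have hset : ∫ v, responseSlope M C j x v ∂(C.lawV x.2) =
      ∫ v in A, responseSlope M C j x v ∂(C.lawV x.2) := by
    refine (setIntegral_eq_integral_of_forall_compl_eq_zero fun v hv => ?_).symm
    have : weight M C x v = 0 := by simpa [hA] using hv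
    rw [hB.responseSlope_eq hx, this, NNReal.coe_zero, zero_mul]
  rw [hset, ProbabilityTheory.cond, integral_smul_measure, smul_eq_mul, ENNReal.toReal_inv,
    ← mul_assoc, ← measureReal_def]
  by_cases h0 : (C.lawV x.2).real A = 0
  · rw [Measure.restrict_eq_zero.2 ((measureReal_eq_zero_iff (measure_ne_top _ _)).1 h0)]
    simp
  · rw [mul_inv_cancel₀ h0, one_mul]

/-- Multiplying by the weight undoes the division in `thresholdLaw`, leaving at most `Rbar` terms
each bounded by `B`, uniformly in `v`. -/
lemma SlopeBound.integrable_weight_mul (hM : M.Honest) (hB : SlopeBound M C j B)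
    (hx : x ∈ M.interiorDir j) {ν : Measure V} [IsFiniteMeasure ν] :
    Integrable (fun p : V × U => (weight M C x p.1 : ℝ) * M.partialH j x p.2)
      (ν ⊗ₘ hM.thresholdKernel C x) := by
  have hDm := hB.measurable_partialH x hx
  have hm : Measurable fun p : V × U => (weight M C x p.1 : ℝ) * M.partialH j x p.2 :=
    (hM.measurable_weight.comp measurable_fst).coe_nnreal_real.mul (hDm.comp measurable_snd)
  refine ⟨hm.aestronglyMeasurable, ?_⟩
  rw [HasFiniteIntegral, Measure.lintegral_compProd hm.enorm]
  have hbd : ∀ v, ∫⁻ u, ‖(weight M C x v : ℝ) * M.partialH j x u‖ₑ ∂(hM.thresholdKernel C x v) ≤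
      M.Rbar * B := by
    intro v
    simp only [enorm_mul]
    rw [lintegral_const_mul _ hDm.enorm]
    have he : ‖(weight M C x v : ℝ)‖ₑ = (weight M C x v : ℝ≥0∞) := by simp [enorm_eq_nnnorm]
    rw [he]
    refine (lintegral_thresholdLaw v _).trans_le ?_
    refine (Finset.sum_le_sum fun k _ => hB.thresholdDens_mul_le hx v k).trans ?_
    simp
  refine (lintegral_mono hbd).trans_lt ?_
  rw [lintegral_const]
  exact ENNReal.mul_lt_top (ENNReal.mul_lt_top (ENNReal.natCast_lt_top _) ENNReal.coe_lt_top)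
    (measure_lt_top _ _)

lemma SlopeBound.integral_weight_mul (hM : M.Honest) (hB : SlopeBound M C j B)
    (hx : x ∈ M.interiorDir j) {ν : Measure V} [IsFiniteMeasure ν] :
    ∫ p, (weight M C x p.1 : ℝ) * M.partialH j x p.2 ∂(ν ⊗ₘ hM.thresholdKernel C x) =
      ∫ v, responseSlope M C j x v ∂ν := by
  rw [Measure.integral_compProd (hB.integrable_weight_mul hM hx)]
  refine integral_congr_ae (ae_of_all _ fun v => ?_)
  simp only [integral_const_mul]
  exact (hB.responseSlope_eq hx v).symm

lemma Model.Honest.isProbabilityMeasure_localLaw (hM : M.Honest)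
    (hA : C.lawV x.2 {v | 0 < weight M C x v} ≠ 0) : IsProbabilityMeasure (localLaw M C x) := by
  have := cond_isProbabilityMeasure hA
  refine ⟨?_⟩
  have hAm : MeasurableSet {v | 0 < weight M C x v} :=
    measurableSet_lt measurable_const hM.measurable_weight
  rw [hM.localLaw_eq, Measure.compProd_apply MeasurableSet.univ]
  calc _ = ∫⁻ _, 1 ∂(ProbabilityTheory.cond (C.lawV x.2) {v | 0 < weight M C x v}) := by
        refine lintegral_congr_ae ?_
        filter_upwards [ae_cond_mem hAm] with v hv using thresholdLaw_univ hv
    _ = 1 := by simp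

/-- The partial effects on the regression function are a common positive multiple of the mean
partial effects at the thresholds, and these determine the covariance of the marginal rate of
substitution with the denominator. -/
theorem exists_pos_partial_effects {j₁ j₂ : Fin J} {B₁ B₂ : ℝ≥0} (hM : M.Honest)
    (h₁ : SlopeBound M C j₁ B₁) (h₂ : SlopeBound M C j₂ B₂)
    (hx₁ : x ∈ M.interiorDir j₁) (hx₂ : x ∈ M.interiorDir j₂)
    (hind : IndepFun Prod.fst Prod.snd (localLaw M C x))
    (hmrs : Integrable (fun p => M.mrs j₁ j₂ x p.2) (localLaw M C x))
    (hne : ∫ v, responseSlope M C j₂ x v ∂(C.lawV x.2) ≠ 0) :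
    ∃ t > 0,
      ∫ v, responseSlope M C j₁ x v ∂(C.lawV x.2) =
        t * ∫ p, M.partialH j₁ x p.2 ∂(localLaw M C x) ∧
      ∫ v, responseSlope M C j₂ x v ∂(C.lawV x.2) =
        t * ∫ p, M.partialH j₂ x p.2 ∂(localLaw M C x) ∧
      cov[fun p => M.mrs j₁ j₂ x p.2, fun p => M.partialH j₂ x p.2; localLaw M C x] =
        ∫ p, M.partialH j₁ x p.2 ∂(localLaw M C x) -
          (∫ p, M.mrs j₁ j₂ x p.2 ∂(localLaw M C x)) *
            ∫ p, M.partialH j₂ x p.2 ∂(localLaw M C x) := by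
  -- A nonzero partial effect guarantees that the conditioning event has positive probability, so
  -- that the local law is a probability measure.
  have hA : (C.lawV x.2).real {v | 0 < weight M C x v} ≠ 0 := by
    intro h0
    rw [integral_responseSlope_eq_mul h₂ hx₂, h0, zero_mul] at hne
    exact hne rfl
  have hA' : C.lawV x.2 {v | 0 < weight M C x v} ≠ 0 := fun h => hA (by simp [measureReal_def, h])
  have := cond_isProbabilityMeasure hA'
  have := hM.isProbabilityMeasure_localLaw hA'
  have hint₁ := h₁.integral_weight_mul hM hx₁
    (ν := ProbabilityTheory.cond (C.lawV x.2) {v | 0 < weight M C x v})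
  have hint₂ := h₂.integral_weight_mul hM hx₂
    (ν := ProbabilityTheory.cond (C.lawV x.2) {v | 0 < weight M C x v})
  have hI₁ := h₁.integrable_weight_mul hM hx₁
    (ν := ProbabilityTheory.cond (C.lawV x.2) {v | 0 < weight M C x v})
  have hm₁ := h₁.measurable_partialH x hx₁
  have hm₂ := h₂.measurable_partialH x hx₂
  have hwm : Measurable fun v => (weight M C x v : ℝ) := hM.measurable_weight.coe_nnreal_real
  have hae : ∀ᵐ p ∂(localLaw M C x), M.partialH j₂ x p.2 ≠ 0 := by
    rw [hM.localLaw_eq]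
    exact Measure.ae_compProd_of_ae_ae
      ((hm₂.comp measurable_snd) (measurableSet_singleton (0 : ℝ)).compl)
      (ae_of_all _ fun v => h₂.ae_thresholdLaw_ne_zero hx₂ v)
  rw [← hM.localLaw_eq] at hint₁ hint₂ hI₁
  rw [integral_responseSlope_eq_mul h₁ hx₁, integral_responseSlope_eq_mul h₂ hx₂,
    ← hint₁, ← hint₂]
  rw [integral_responseSlope_eq_mul h₂ hx₂, ← hint₂] at hne
  obtain ⟨t, ht, e₁, e₂, e₃⟩ := IndepFun.covariance_div_left (L := localLaw M C x)
    (w := fun p => (weight M C x p.1 : ℝ)) (D₁ := fun p => M.partialH j₁ x p.2)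
    (D₂ := fun p => M.partialH j₂ x p.2) (fun p => NNReal.coe_nonneg _)
    (hwm.comp measurable_fst) (hm₁.comp measurable_snd) (hm₂.comp measurable_snd)
    (hind.comp hwm hm₁) (hind.comp hwm hm₂) hI₁ hae hmrs (right_ne_zero_of_mul hne)
  -- The common factor is `P(w > 0)` times the local mean of the weight.
  refine ⟨(C.lawV x.2).real {v | 0 < weight M C x v} * t,
    mul_pos (measureReal_nonneg.lt_of_ne' hA) ht, ?_, ?_, e₃⟩
  · rw [e₁, mul_assoc]
  · rw [e₂, mul_assoc]

end Reporting

/-! ### The main result. -/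

theorem proposition1
    {J K : ℕ} {U V Ω : Type*}
    [MeasurableSpace U] [StandardBorelSpace U] [MeasurableSpace V] [StandardBorelSpace V]
    [MeasurableSpace Ω] [StandardBorelSpace Ω] (P : Measure Ω) [IsProbabilityMeasure P]
    (M : Reporting.Model J K U V) (C : Reporting.CondLaws J K U V)
    (T : Ω → Fin J → ℝ) (W : Ω → Fin K → ℝ) (Uvar : Ω → U) (Vvar : Ω → V)
    (hT : Measurable T) (hW : Measurable W) (hU : Measurable Uvar) (hV : Measurable Vvar)
    (hX : ∀ᵐ ω ∂P, (T ω, W ω) ∈ M.X)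
    (hC : C.IsVersion M P W Uvar Vvar)
    (hHonest : M.Honest)
    (hExog : Reporting.Exog P T W Uvar Vvar hW hV)
    (j₁ j₂ : Fin J)
    (hReg₁ : Reporting.Reg M C P T j₁) (hReg₂ : Reporting.Reg M C P T j₂) :
    -- `regression M C` is a version of `x ↦ E[R | X = x]`, where `R = r(h(X,U),V)`
    (fun ω => Reporting.regression M C (T ω, W ω)) =ᵐ[P]
      P[fun ω => (M.r (M.h (T ω, W ω) (Uvar ω)) (Vvar ω) : ℝ) |
        MeasurableSpace.comap (fun ω => (T ω, W ω)) inferInstance] ∧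
    ∀ x ∈ M.interiorDir j₁ ∩ M.interiorDir j₂,
      DifferentiableAt ℝ (fun s => Reporting.regression M C (Reporting.setComp x j₁ s)) (x.1 j₁) ∧
      DifferentiableAt ℝ (fun s => Reporting.regression M C (Reporting.setComp x j₂ s)) (x.1 j₂) ∧
      -- `V` and `U` are independent given `H ∈ τ_V, X = x`; the average MRS there exists
      (IndepFun Prod.fst Prod.snd (Reporting.localLaw M C x) →
        Integrable (fun p => M.mrs j₁ j₂ x p.2) (Reporting.localLaw M C x) →
        (Reporting.partialRegression M C j₂ x ≠ 0 →
          cov[fun p => M.mrs j₁ j₂ x p.2, fun p => M.partialH j₂ x p.2;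
            Reporting.localLaw M C x] = 0 →
          ∫ p, M.mrs j₁ j₂ x p.2 ∂(Reporting.localLaw M C x) =
            Reporting.partialRegression M C j₁ x / Reporting.partialRegression M C j₂ x) ∧
        (0 < Reporting.partialRegression M C j₂ x →
          (cov[fun p => M.mrs j₁ j₂ x p.2, fun p => M.partialH j₂ x p.2;
              Reporting.localLaw M C x] ≤ 0 →
            Reporting.partialRegression M C j₁ x / Reporting.partialRegression M C j₂ x ≤
              ∫ p, M.mrs j₁ j₂ x p.2 ∂(Reporting.localLaw M C x)) ∧
          (0 ≤ cov[fun p => M.mrs j₁ j₂ x p.2, fun p => M.partialH j₂ x p.2;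
              Reporting.localLaw M C x] →
            ∫ p, M.mrs j₁ j₂ x p.2 ∂(Reporting.localLaw M C x) ≤
              Reporting.partialRegression M C j₁ x / Reporting.partialRegression M C j₂ x))) := by
  refine ⟨Reporting.regression_ae_eq_condExp hT hW hU hV hX hC hExog, fun x ⟨hx₁, hx₂⟩ => ?_⟩
  obtain ⟨B₁, h₁⟩ := hReg₁.exists_slopeBound
  obtain ⟨B₂, h₂⟩ := hReg₂.exists_slopeBound
  have hd₁ := h₁.hasDerivAt_regression hHonest hC hx₁
  have hd₂ := h₂.hasDerivAt_regression hHonest hC hx₂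
  refine ⟨hd₁.differentiableAt, hd₂.differentiableAt, fun hind hmrs => ?_⟩
  have hp₁ : Reporting.partialRegression M C j₁ x = _ := hd₁.deriv
  have hp₂ : Reporting.partialRegression M C j₂ x = _ := hd₂.deriv
  rw [hp₁, hp₂]
  refine ⟨fun hne hcov => ?_, fun hpos => ?_⟩
  · obtain ⟨t, ht, e₁, e₂, e₃⟩ :=
      Reporting.exists_pos_partial_effects hHonest h₁ h₂ hx₁ hx₂ hind hmrs hne
    rw [e₂] at hne
    rw [hcov] at e₃
    rw [e₁, e₂, mul_div_mul_left _ _ ht.ne', eq_div_iff (right_ne_zero_of_mul hne)]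
    linarith
  · obtain ⟨t, ht, e₁, e₂, e₃⟩ :=
      Reporting.exists_pos_partial_effects hHonest h₁ h₂ hx₁ hx₂ hind hmrs hpos.ne'
    rw [e₂] at hpos
    -- Since `t > 0`, the local mean of `∂_2 h` inherits the sign of the partial effect, and
    -- clearing it from the denominator preserves the inequalities.
    have hD := (mul_pos_iff_of_pos_left ht).1 hpos
    rw [e₁, e₂, e₃, mul_div_mul_left _ _ ht.ne', div_le_iff₀ hD, le_div_iff₀ hD]
    exact ⟨fun h => by linarith, fun h => by linarith⟩
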